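/- Let $G$ be a finite simple graph with $m$ edges. For each edge $\langle jk\rangle$ let $C_{\langle jk\rangle}=\tfrac12(1-Z_jZ_k)$, acting on one qubit per vertex, and put $C=\sum_{\langle jk\rangle}C_{\langle jk\rangle}$ (the MaxCut cost operator) and $B=\sum_j X_j$. For $p\in\mathbb N$ and angles $\gamma,\beta\in\mathbb R^p$ let $$|\gamma,\beta\rangle=e^{-i\beta_pB}e^{-i\gamma_pC}\cdots e^{-i\beta_1B}e^{-i\gamma_1C}|s\rangle ,$$ where $|s\rangle$ is the uniform superposition of all bit strings, and let $$F_p(\gamma,\beta)=\langle\gamma,\beta|C|\gamma,\beta\rangle,\qquad F_e(\gamma,\beta)=\langle\gamma,\beta|C_e|\gamma,\beta\rangle .$$ We write $F_p^G$, $F_e^G$ when the graph matters. The radius-$p$ neighborhood of an edge $e$ is the subgraph of $G$ whose vertices are those at distance at most $p$ from an endpoint of $e$ and whose edges are $e$ and all edges with an end at distance less than $p$ from an endpoint of $e$. Let $T_p$ be the tree of depth $p$ around a central edge, in which each of the two endpoints of the central edge, and each of their descendants, at depth less than $p$ has exactly two children; let $F_{\mathrm{tree}}(\gamma,\beta)$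 be the term of the central edge for the graph $T_p$. For $m>0$ let $f_p(G)$ be the fraction of the edges of $G$ whose radius-$p$ neighborhood is not a tree. Fix $p$. Then: 1. For every finite graph, $F_p(\gamma,\beta)=\sum_e F_e(\gamma,\beta)$ for all $\gamma,\beta$. 2. $F_e$ is determined by the radius-$p$ neighborhood of $e$: if $e$ is an edge of $G$, $e'$ is an edge of $G'$ and there is an isomorphism between their radius-$p$ neighborhoods that maps the endpoints of $e$ to those of $e'$, then $F_e^{G}(\gamma,\beta)=F_{e'}^{G'}(\gamma,\beta)$ for all $\gamma,\beta$. 3. If $G$ is 3-regular and the radius-$p$ neighborhood of the edge $e$ is a tree, then $F_e(\gamma,\beta)=F_{\mathrm{tree}}(\gamma,\beta)$ for all $\gamma,\beta$. Consequently $|F_p(\gamma,\beta)/m-F_{\mathrm{tree}}(\gamma,\beta)|\le f_p(G)$ for every nonempty finite 3-regular graph $G$ and all $\gamma,\beta$. 4. For a uniformly random 3-regular graph $G$ on $n$ labelled vertices ($n\ge4$ even), the non-tree fraction is $O(1/n)$ in mean: there is a constant $K$ depending only on $p$ with $\mathbb E[f_p(G)]\le K/n$ for all even $n\ge 4$. 5.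 The landscape concentrates. For every $\varepsilon>0$ there is a constant $K$ depending only on $p$ and $\varepsilon$ such that for all even $n\ge4$, with probability at least $1-\varepsilon$, $$f_p(G)\le K/n\quad\text{and}\quad |F_p(\gamma,\beta)/m-F_{\mathrm{tree}}(\gamma,\beta)|\le K/n\ \text{ for all }\gamma,\beta .$$ In particular, for every $\delta>0$ the probability that $|F_p(\gamma,\beta)/m-F_{\mathrm{tree}}(\gamma,\beta)|\le\delta$ for all $\gamma,\beta$ tends to $1$ as $n\to\infty$ through even integers. 6. The landscape is essentially independent of the instance: for every $\varepsilon>0$ there is a constant $K$ depending only on $p$ and $\varepsilon$ such that for all even $n\ge4$, two independent uniformly random 3-regular graphs $G,G'$ on $n$ vertices satisfy, with probability at least $1-\varepsilon$, $|F_p^{G}(\gamma,\beta)/m-F_p^{G'}(\gamma,\beta)/m|\le K/n$ for all $\gamma,\beta$, where $m=3n/2$. -/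

import Mathlib

open scoped Classical Matrix
open Filter Topology Finset

noncomputable section

namespace QAOA

/-! ### The QAOA for MaxCut -/

section Circuit

variable {V : Type*} [Fintype V]

/-- Operators on the Hilbert space of dimension `2 ^ |V|` whose computational basis is indexed by
the bit strings `z : V → Bool` (one qubit for each vertex). -/
abbrev Operator (V : Type*) : Type _ := Matrix (V → Bool) (V → Bool) ℂ

/-- The Pauli operator `Z` on qubit `j`. -/
def pauliZ (j : V) : Operator V :=
  Matrix.diagonal fun z => if z j then -1 else 1

/-- The Pauli operator `X` on qubit `j`; it flips bit `j`. -/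
def pauliX (j : V) : Operator V :=
  Matrix.of fun z w => if w = Function.update z j (!z j) then 1 else 0

/-- The MaxCut clause `(1 - Z_j Z_k) / 2` of the pair `{j, k}`. -/
def clauseOp (e : Sym2 V) : Operator V :=
  Sym2.lift ⟨fun j k => (1 / 2 : ℂ) • (1 - pauliZ j * pauliZ k), fun j k => by
    simp only [pauliZ, Matrix.diagonal_mul_diagonal, mul_comm]⟩ e

/-- The MaxCut cost operator: the sum of the clauses of all edges. -/
def costOp (G : SimpleGraph V) : Operator V :=
  ∑ e ∈ G.edgeFinset, clauseOp e

/-- The operator `B`, the sum of all `X_j`. -/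
def mixerOp (V : Type*) [Fintype V] : Operator V :=
  ∑ j : V, pauliX j

/-- `U(C, γ) = exp (-i γ C)`. -/
def costUnitary (G : SimpleGraph V) (γ : ℝ) : Operator V :=
  NormedSpace.exp ((-(Complex.I * (γ : ℂ))) • costOp G)

/-- `U(B, β) = exp (-i β B)`. -/
def mixerUnitary (V : Type*) [Fintype V] (β : ℝ) : Operator V :=
  NormedSpace.exp ((-(Complex.I * (β : ℂ))) • mixerOp V)

/-- The uniform superposition of all bit strings. -/
def uniformState (V : Type*) [Fintype V] : (V → Bool) → ℂ :=
  fun _ => 1 / (Real.sqrt (2 ^ Fintype.card V) : ℂ)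

/-- The depth `p` state `U(B, β_p) U(C, γ_p) ⋯ U(B, β_1) U(C, γ_1) |s⟩`; the angle `γ_i` is
`γ (i - 1)`, so that the last index is applied last. -/
def state (G : SimpleGraph V) : (p : ℕ) → (Fin p → ℝ) → (Fin p → ℝ) → (V → Bool) → ℂ
  | 0, _, _ => uniformState V
  | p + 1, γ, β =>
    mixerUnitary V (β (Fin.last p)) *ᵥ
      (costUnitary G (γ (Fin.last p)) *ᵥ
        state G p (fun i => γ i.castSucc) (fun i => β i.castSucc))

/-- The expectation `⟨ψ| A |ψ⟩`, which is a real number for the Hermitian operators `A` used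
below. -/
def expectation (A : Operator V) (ψ : (V → Bool) → ℂ) : ℝ :=
  (star ψ ⬝ᵥ (A *ᵥ ψ)).re

/-- The objective function `F_p(γ, β)` of the instance `G`. -/
def objective (G : SimpleGraph V) {p : ℕ} (γ β : Fin p → ℝ) : ℝ :=
  expectation (costOp G) (state G p γ β)

/-- The contribution of the single edge `e` to the objective function of `G`. -/
def edgeTerm (G : SimpleGraph V) (e : Sym2 V) {p : ℕ} (γ β : Fin p → ℝ) : ℝ :=
  expectation (clauseOp e) (state G p γ β)

end Circuit

/-! ### Neighborhoods of edges -/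

section Neighborhood

variable {V : Type*}

/-- The radius `p` neighborhood of the edge `e`: its vertices are those at distance at most `p`
from an endpoint of `e`, and its edges are `e` and all edges of `G` that have an end at distance
less than `p` from an endpoint of `e`. (An edge between two vertices that both have distance `p`
does not belong to it.) -/
def edgeNbhd (G : SimpleGraph V) (e : Sym2 V) (p : ℕ) : G.Subgraph where
  verts := {v | ∃ w ∈ e, G.edist w v ≤ p}
  Adj u v := G.Adj u v ∧
    (s(u, v) = e ∨ (∃ w ∈ e, G.edist w u < p) ∨ (∃ w ∈ e, G.edist w v < p))
  adj_sub h := h.1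
  edge_vert := by
    rintro u v ⟨huv, h | ⟨w, hw, h⟩ | ⟨w, hw, h⟩⟩
    · exact ⟨u, h ▸ Sym2.mem_mk_left u v, by simp⟩
    · exact ⟨w, hw, h.le⟩
    · refine ⟨w, hw, ?_⟩
      have h1 : G.edist v u ≤ 1 := by
        simpa using (SimpleGraph.Walk.cons huv.symm SimpleGraph.Walk.nil).edist_le
      calc G.edist w u ≤ G.edist w v + G.edist v u := G.edist_triangle
        _ ≤ G.edist w v + 1 := by gcongr
        _ ≤ p := Order.add_one_le_of_lt h
  symm := ⟨by
    rintro u v ⟨huv, h⟩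
    refine ⟨huv.symm, ?_⟩
    rcases h with h | h | h
    · exact Or.inl (Sym2.eq_swap.trans h)
    · exact Or.inr (Or.inr h)
    · exact Or.inr (Or.inl h)⟩

/-- The neighborhood of `e` in `G` and the neighborhood of `f` in `H` are isomorphic as graphs with
a distinguished edge. -/
def SameNbhd {W : Type*} (G : SimpleGraph V) (e : Sym2 V) (H : SimpleGraph W) (f : Sym2 W)
    (p : ℕ) : Prop :=
  ∃ φ : (edgeNbhd G e p).coe ≃g (edgeNbhd H f p).coe,
    ∀ v : (edgeNbhd G e p).verts, (v : V) ∈ e ↔ (φ v : W) ∈ f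

/-- The radius `p` neighborhood of `e` is a tree. -/
def IsTreeLike (G : SimpleGraph V) (e : Sym2 V) (p : ℕ) : Prop :=
  (edgeNbhd G e p).coe.IsTree

/-- The fraction of the edges of `G` whose radius `p` neighborhood is not a tree. -/
def nonTreeFraction [Fintype V] (G : SimpleGraph V) (p : ℕ) : ℝ :=
  (#{e ∈ G.edgeFinset | ¬ IsTreeLike G e p} : ℝ) / #G.edgeFinset

end Neighborhood

/-! ### The tree term -/

/-- Vertices of the tree of depth `p` around an edge: an endpoint of the central edge and
a descending path of at most `p` binary choices (most recent choice first). -/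
abbrev TreeVertex (p : ℕ) : Type := Bool × {l : List Bool // l.length ≤ p}

instance (p : ℕ) : Fintype {l : List Bool // l.length ≤ p} :=
  (List.finite_length_le Bool p).fintype

/-- The tree of depth `p` around an edge: the two endpoints of the central edge are adjacent,
and every vertex at depth less than `p` has two children, hence degree three. -/
def edgeTree (p : ℕ) : SimpleGraph (TreeVertex p) :=
  SimpleGraph.fromRel fun x y =>
    (x.2.1 = [] ∧ y.2.1 = [] ∧ x.1 ≠ y.1) ∨ (x.1 = y.1 ∧ ∃ b, y.2.1 = b :: x.2.1)

/-- The central edge of `edgeTree p`. -/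
def centralEdge (p : ℕ) : Sym2 (TreeVertex p) :=
  s((false, ⟨[], Nat.zero_le p⟩), (true, ⟨[], Nat.zero_le p⟩))

/-- The tree-neighborhood term: the contribution of the central edge of the depth `p` tree. -/
def treeTerm {p : ℕ} (γ β : Fin p → ℝ) : ℝ :=
  edgeTerm (edgeTree p) (centralEdge p) γ β

/-! ### Uniformly random 3-regular graphs -/

/-- The 3-regular simple graphs on the vertex set `{0, …, n - 1}`. -/
def cubicGraphs (n : ℕ) : Finset (SimpleGraph (Fin n)) :=
  {G | G.IsRegularOfDegree 3}

/-- The probability of `P` for a uniformly random 3-regular graph on `n` vertices. -/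
def cubicProb (n : ℕ) (P : SimpleGraph (Fin n) → Prop) : ℝ :=
  (#{G ∈ cubicGraphs n | P G} : ℝ) / #(cubicGraphs n)

/-- The mean of `X` for a uniformly random 3-regular graph on `n` vertices. -/
def cubicMean (n : ℕ) (X : SimpleGraph (Fin n) → ℝ) : ℝ :=
  (∑ G ∈ cubicGraphs n, X G) / #(cubicGraphs n)

/-- The probability of `P` for two independent uniformly random 3-regular graphs on `n`
vertices. -/
def cubicPairProb (n : ℕ) (P : SimpleGraph (Fin n) → SimpleGraph (Fin n) → Prop) : ℝ :=
  (#{q ∈ cubicGraphs n ×ˢ cubicGraphs n | P q.1 q.2} : ℝ) / #(cubicGraphs n ×ˢ cubicGraphs n)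

/-- The objective function of `G` divided by the number of edges. -/
def objectivePerEdge {V : Type*} [Fintype V] (G : SimpleGraph V) {p : ℕ} (γ β : Fin p → ℝ) : ℝ :=
  objective G γ β / #G.edgeFinset

end QAOA

end

/-!
Conjugating a diagonal observable by `exp (-i β B)` does not enlarge the set of qubits on which it
acts, and conjugating it by `exp (-i γ C)` enlarges this set by neighboring vertices only, since the
factors of the edges that do not meet it cancel. In the Heisenberg picture the term of `e` therefore
only involves the vertices at distance at most `p` from `e` and the edges that leave vertices at
distance less than `p`. Hence an injective graph map that is a bijection on the neighbors of all
vertices at distance less than `p` from `e` preserves the term of `e`.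

For a 3-regular graph the non-backtracking walks that start with `e` define such a map from the tree
of depth `p`; it is always locally injective, and injective if the neighborhood of `e` is a tree.

If the neighborhood of `e` is not a tree, then `e` lies within distance `p` of an edge on a cycle of
bounded length. In a random `d`-regular graph on `n` vertices the expected number of these edges is
bounded independently of `n`: switching an edge `xy` of a short cycle with a far away edge `ab`
(about `d * n` choices) leaves `x` and `y` close to each other, and the switching can be recovered
from the new graph and such a close pair with marked neighbors (at most a constant times `n`
choices). Markov's inequality turns this into concentration of the landscape.
-/

noncomputable section

namespace QAOA

/-! ### Heisenberg evolution -/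

section Heisenberg

open NormedSpace

variable {n : Type*} [Fintype n] [DecidableEq n]

/-- The propagator `exp (-i θ A)` of the Hamiltonian `A` at time `θ`. -/
def propagator (θ : ℝ) (A : Matrix n n ℂ) : Matrix n n ℂ :=
  exp ((-(Complex.I * (θ : ℂ))) • A)

/-- The observable `O` at time `θ` in the Heisenberg picture of the Hamiltonian `A`; for Hermitian
`A` this is the conjugate of `O` by the propagator. -/
def heisenberg (θ : ℝ) (A O : Matrix n n ℂ) : Matrix n n ℂ :=
  propagator (-θ) A * O * propagator θ A

lemma commute_propagator {A D : Matrix n n ℂ} (h : Commute A D) (θ : ℝ) :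
    Commute (propagator θ A) D :=
  (h.smul_left _).exp_left

lemma propagator_add {A B : Matrix n n ℂ} (h : Commute A B) (θ : ℝ) :
    propagator θ (A + B) = propagator θ A * propagator θ B := by
  rw [propagator, smul_add, Matrix.exp_add_of_commute _ _ ((h.smul_left _).smul_right _)]
  rfl

lemma propagator_neg_mul_self (θ : ℝ) (A : Matrix n n ℂ) :
    propagator (-θ) A * propagator θ A = 1 := by
  rw [propagator, propagator, ← Matrix.exp_add_of_commute, ← add_smul]
  · simp
  · exact ((Commute.refl A).smul_left _).smul_right _

lemma conjTranspose_propagator {A : Matrix n n ℂ} (hA : A.IsHermitian) (θ : ℝ) :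
    (propagator θ A)ᴴ = propagator (-θ) A := by
  rw [propagator, propagator, ← Matrix.exp_conjTranspose, Matrix.conjTranspose_smul, hA.eq]
  congr 2
  simp [Complex.conj_ofReal]

lemma commute_heisenberg {A O D : Matrix n n ℂ} (hA : Commute A D) (hO : Commute O D) (θ : ℝ) :
    Commute (heisenberg θ A O) D :=
  ((commute_propagator hA _).mul_left hO).mul_left (commute_propagator hA _)

lemma heisenberg_one (θ : ℝ) (A : Matrix n n ℂ) : heisenberg θ A 1 = 1 := by
  rw [heisenberg, mul_one, propagator_neg_mul_self]

lemma heisenberg_add_of_commute {A B O : Matrix n n ℂ} (hAB : Commute A B) (hBO : Commute B O)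
    (θ : ℝ) : heisenberg θ (A + B) O = heisenberg θ A O := by
  calc heisenberg θ (A + B) O
      = propagator (-θ) A * propagator (-θ) B * O * (propagator θ B * propagator θ A) := by
        rw [heisenberg, propagator_add hAB, add_comm, propagator_add hAB.symm]
    _ = propagator (-θ) A * (propagator (-θ) B * (O * propagator θ B)) * propagator θ A := by
        noncomm_ring
    _ = heisenberg θ A O := by
        rw [← (commute_propagator hBO θ).eq, ← mul_assoc (propagator (-θ) B),
          propagator_neg_mul_self, one_mul, heisenberg]

lemma heisenberg_sum_eq_of_subset {ι : Type*} {s t : Finset ι} (hst : s ⊆ t)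
    {A : ι → Matrix n n ℂ} (hA : ∀ i j, Commute (A i) (A j)) {O : Matrix n n ℂ}
    (hO : ∀ i ∈ t, i ∉ s → Commute (A i) O) (θ : ℝ) :
    heisenberg θ (∑ i ∈ t, A i) O = heisenberg θ (∑ i ∈ s, A i) O := by
  rw [← sum_sdiff hst, add_comm]
  refine heisenberg_add_of_commute
    (Commute.sum_left _ _ _ fun i _ => Commute.sum_right _ _ _ fun j _ => hA i j)
    (Commute.sum_left _ _ _ fun i hi => ?_) θ
  obtain ⟨hit, his⟩ := mem_sdiff.1 hi
  exact hO i hit his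

end Heisenberg

section Expectation

variable {V : Type*} [Fintype V]

lemma expectation_sum {ι : Type*} (s : Finset ι) (A : ι → Operator V) (ψ : (V → Bool) → ℂ) :
    expectation (∑ i ∈ s, A i) ψ = ∑ i ∈ s, expectation (A i) ψ := by
  simp only [expectation, Matrix.sum_mulVec, dotProduct_sum, Complex.re_sum]

lemma expectation_propagator_mulVec {A : Operator V} (hA : A.IsHermitian) (O : Operator V)
    (θ : ℝ) (ψ : (V → Bool) → ℂ) :
    expectation O (propagator θ A *ᵥ ψ) = expectation (heisenberg θ A O) ψ := by
  rw [expectation, expectation, heisenberg, ← conjTranspose_propagator hA, Matrix.star_mulVec,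
    ← Matrix.dotProduct_mulVec, Matrix.mulVec_mulVec, Matrix.mulVec_mulVec, mul_assoc]

lemma expectation_diagonal (c : (V → Bool) → ℝ) (ψ : (V → Bool) → ℂ) :
    expectation (Matrix.diagonal fun z => (c z : ℂ)) ψ = ∑ z, c z * Complex.normSq (ψ z) := by
  simp only [expectation, dotProduct, Matrix.mulVec_diagonal, Complex.re_sum]
  refine sum_congr rfl fun z _ => ?_
  simp only [Pi.star_apply, RCLike.star_def, Complex.normSq_apply, Complex.mul_re, Complex.mul_im,
    Complex.conj_re, Complex.conj_im, Complex.ofReal_re, Complex.ofReal_im]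
  ring

lemma expectation_diagonal_mem_Icc {c : (V → Bool) → ℝ} (hc : ∀ z, c z ∈ Set.Icc 0 1)
    {ψ : (V → Bool) → ℂ} (hψ : expectation 1 ψ = 1) :
    expectation (Matrix.diagonal fun z => (c z : ℂ)) ψ ∈ Set.Icc 0 1 := by
  have hnorm : ∑ z, Complex.normSq (ψ z) = 1 := by
    simpa using (expectation_diagonal 1 ψ).symm.trans (by simpa using hψ)
  rw [expectation_diagonal]
  exact ⟨sum_nonneg fun z _ => mul_nonneg (hc z).1 (Complex.normSq_nonneg _),
    hnorm ▸ sum_le_sum fun z _ => mul_le_of_le_one_left (Complex.normSq_nonneg _) (hc z).2⟩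

lemma star_uniformState_mul (z w : V → Bool) :
    star (uniformState V z) * uniformState V w = (Fintype.card (V → Bool) : ℂ)⁻¹ := by
  have hsqrt : (Real.sqrt (2 ^ Fintype.card V) : ℂ) * Real.sqrt (2 ^ Fintype.card V) =
      2 ^ Fintype.card V := by
    rw [← Complex.ofReal_mul, Real.mul_self_sqrt (by positivity)]
    simp
  simp [uniformState, ← mul_inv, hsqrt]

lemma expectation_uniformState (A : Operator V) :
    expectation A (uniformState V) = ((∑ z, ∑ w, A z w) / Fintype.card (V → Bool)).re := by
  simp only [expectation, dotProduct, Matrix.mulVec, mul_sum, Pi.star_apply, mul_left_comm,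
    star_uniformState_mul, div_eq_mul_inv, sum_mul]

lemma expectation_one_uniformState : expectation (1 : Operator V) (uniformState V) = 1 := by
  simp [expectation_uniformState, Matrix.one_apply]

end Expectation

/-! ### The operators of the circuit -/

section Pauli

/-- The bit string `z` with bit `j` flipped. -/
def flipBit {V : Type*} (j : V) (z : V → Bool) : V → Bool :=
  Function.update z j (!z j)

lemma flipBit_apply {V : Type*} (j k : V) (z : V → Bool) :
    flipBit j z k = if k = j then !z j else z k :=
  Function.update_apply ..

lemma flipBit_involutive {V : Type*} (j : V) : Function.Involutive (flipBit j) := by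
  intro z
  ext k
  grind [flipBit_apply]

lemma flipBit_comm {V : Type*} (j k : V) (z : V → Bool) :
    flipBit j (flipBit k z) = flipBit k (flipBit j z) := by
  ext l
  grind [flipBit_apply]

lemma flipBit_eq_iff {V : Type*} {j : V} {z w : V → Bool} : flipBit j z = w ↔ z = flipBit j w :=
  (flipBit_involutive j).eq_iff

variable {V : Type*} [Fintype V]

lemma pauliX_apply (j : V) (z w : V → Bool) :
    pauliX j z w = if w = flipBit j z then 1 else 0 := rfl

lemma pauliX_mul_apply (j : V) (A : Operator V) (z w : V → Bool) :
    (pauliX j * A) z w = A (flipBit j z) w := by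
  simp [Matrix.mul_apply, pauliX_apply]

lemma mul_pauliX_apply (j : V) (A : Operator V) (z w : V → Bool) :
    (A * pauliX j) z w = A z (flipBit j w) := by
  simp [Matrix.mul_apply, pauliX_apply, eq_comm (a := w), flipBit_eq_iff]

lemma commute_pauliZ_pauliZ (j k : V) : Commute (pauliZ j) (pauliZ k) :=
  Matrix.commute_diagonal _ _

lemma commute_pauliX_pauliX (j k : V) : Commute (pauliX j) (pauliX k) := by
  ext z w
  simp only [mul_pauliX_apply, pauliX_apply, flipBit_eq_iff, flipBit_comm j k]

lemma commute_pauliX_pauliZ {j k : V} (h : j ≠ k) : Commute (pauliX j) (pauliZ k) := by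
  ext z w
  simp only [pauliX_mul_apply, mul_pauliX_apply, pauliZ, Matrix.diagonal_apply, flipBit_eq_iff,
    flipBit_apply, h.symm, if_false]

lemma isHermitian_pauliX (j : V) : (pauliX j).IsHermitian := by
  ext z w
  simp [pauliX_apply, Matrix.conjTranspose_apply, eq_comm (a := z), flipBit_eq_iff]

lemma clauseOp_mk (j k : V) :
    clauseOp s(j, k) = (1 / 2 : ℂ) • (1 - pauliZ j * pauliZ k) := rfl

lemma clauseOp_mk_eq_diagonal (j k : V) :
    clauseOp s(j, k) = Matrix.diagonal fun z => ((if z j = z k then 0 else 1 : ℝ) : ℂ) := by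
  rw [clauseOp_mk, pauliZ, pauliZ, Matrix.diagonal_mul_diagonal, ← Matrix.diagonal_one,
    Matrix.diagonal_sub, ← Matrix.diagonal_smul]
  congr 1
  ext z
  cases hj : z j <;> cases hk : z k <;> simp [hj, hk] <;> norm_num

lemma commute_clauseOp_of_forall_mem {A : Operator V} {e : Sym2 V}
    (h : ∀ j ∈ e, Commute (pauliZ j) A) : Commute (clauseOp e) A := by
  induction e with | _ j k
  have hjk : Commute (1 - pauliZ j * pauliZ k) A := (Commute.one_left A).sub_left
    ((h j (Sym2.mem_mk_left j k)).mul_left (h k (Sym2.mem_mk_right j k)))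
  exact hjk.smul_left (1 / 2 : ℂ)

lemma commute_clauseOp_pauliZ (e : Sym2 V) (j : V) : Commute (clauseOp e) (pauliZ j) :=
  commute_clauseOp_of_forall_mem fun k _ => commute_pauliZ_pauliZ k j

lemma commute_clauseOp_clauseOp (e f : Sym2 V) : Commute (clauseOp e) (clauseOp f) :=
  commute_clauseOp_of_forall_mem fun j _ => (commute_clauseOp_pauliZ f j).symm

lemma commute_clauseOp_pauliX {e : Sym2 V} {j : V} (h : j ∉ e) :
    Commute (clauseOp e) (pauliX j) :=
  commute_clauseOp_of_forall_mem fun _ hk =>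
    (commute_pauliX_pauliZ (ne_of_mem_of_not_mem hk h).symm).symm

lemma isHermitian_clauseOp (e : Sym2 V) : (clauseOp e).IsHermitian := by
  induction e with | _ j k
  rw [clauseOp_mk_eq_diagonal]
  exact Matrix.isHermitian_diagonal_of_self_adjoint _ (by ext z; simp)

lemma isHermitian_costOp (G : SimpleGraph V) : (costOp G).IsHermitian :=
  (isSelfAdjoint_sum _ fun e _ => (isHermitian_clauseOp e).isSelfAdjoint).isHermitian

lemma isHermitian_mixerOp : (mixerOp V).IsHermitian :=
  (isSelfAdjoint_sum _ fun j _ => (isHermitian_pauliX j).isSelfAdjoint).isHermitian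

end Pauli

section Layer

variable {V : Type*} [Fintype V]

/-- One layer of the circuit in the Heisenberg picture. The mixer acts on the observable first,
because it is the factor of the layer that is applied to the state last. -/
def layer (G : SimpleGraph V) (γ β : ℝ) (O : Operator V) : Operator V :=
  heisenberg γ (costOp G) (heisenberg β (mixerOp V) O)

lemma layer_one (G : SimpleGraph V) (γ β : ℝ) : layer G γ β 1 = 1 := by
  rw [layer, heisenberg_one, heisenberg_one]

lemma expectation_state_succ (G : SimpleGraph V) {p : ℕ} (γ β : Fin (p + 1) → ℝ)
    (O : Operator V) :
    expectation O (state G (p + 1) γ β) =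
      expectation (layer G (γ (Fin.last p)) (β (Fin.last p)) O)
        (state G p (fun i => γ i.castSucc) (fun i => β i.castSucc)) := by
  rw [layer, ← expectation_propagator_mulVec (isHermitian_costOp G),
    ← expectation_propagator_mulVec isHermitian_mixerOp]
  rfl

lemma expectation_one_state (G : SimpleGraph V) :
    ∀ {p : ℕ} (γ β : Fin p → ℝ), expectation 1 (state G p γ β) = 1
  | 0, _, _ => expectation_one_uniformState
  | p + 1, γ, β => by rw [expectation_state_succ, layer_one, expectation_one_state]

theorem objective_eq_sum_edgeTerm (G : SimpleGraph V) {p : ℕ} (γ β : Fin p → ℝ) :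
    objective G γ β = ∑ e ∈ G.edgeFinset, edgeTerm G e γ β :=
  expectation_sum ..

lemma edgeTerm_mem_Icc (G : SimpleGraph V) (e : Sym2 V) {p : ℕ} (γ β : Fin p → ℝ) :
    edgeTerm G e γ β ∈ Set.Icc 0 1 := by
  induction e with | _ j k
  rw [edgeTerm, clauseOp_mk_eq_diagonal]
  exact expectation_diagonal_mem_Icc (fun z => by split_ifs <;> simp) (expectation_one_state G γ β)

end Layer

/-! ### Supports of observables -/

section Support

variable {V : Type*} [Fintype V]

/-- `O` acts trivially on the qubits outside `T`, expressed by commutation with the Pauli operators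
of those qubits. -/
def SupportedOn (T : Set V) (O : Operator V) : Prop :=
  ∀ j ∉ T, Commute O (pauliX j) ∧ Commute O (pauliZ j)

/-- The vertices of `T` together with all their neighbors. -/
def closedNbhd {V : Type*} (G : SimpleGraph V) (T : Set V) : Set V :=
  T ∪ {y | ∃ x ∈ T, G.Adj x y}

lemma SupportedOn.mono {T T' : Set V} {O : Operator V} (h : SupportedOn T O) (hT : T ⊆ T') :
    SupportedOn T' O :=
  fun j hj => h j fun hjT => hj (hT hjT)

lemma SupportedOn.sum {ι : Type*} {s : Finset ι} {T : Set V} {A : ι → Operator V}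
    (h : ∀ i ∈ s, SupportedOn T (A i)) : SupportedOn T (∑ i ∈ s, A i) :=
  fun j hj => ⟨Commute.sum_left _ _ _ fun i hi => (h i hi j hj).1,
    Commute.sum_left _ _ _ fun i hi => (h i hi j hj).2⟩

lemma SupportedOn.heisenberg {T : Set V} {A O : Operator V} (hA : SupportedOn T A)
    (hO : SupportedOn T O) (θ : ℝ) : SupportedOn T (heisenberg θ A O) :=
  fun j hj => ⟨commute_heisenberg (hA j hj).1 (hO j hj).1 θ,
    commute_heisenberg (hA j hj).2 (hO j hj).2 θ⟩

lemma supportedOn_pauliX {T : Set V} {j : V} (hj : j ∈ T) : SupportedOn T (pauliX j) :=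
  fun _ hk => ⟨commute_pauliX_pauliX _ _, commute_pauliX_pauliZ (ne_of_mem_of_not_mem hj hk)⟩

lemma supportedOn_clauseOp {T : Set V} {e : Sym2 V} (h : ∀ x ∈ e, x ∈ T) :
    SupportedOn T (clauseOp e) :=
  fun j hj => ⟨commute_clauseOp_pauliX fun hje => hj (h j hje), commute_clauseOp_pauliZ e j⟩

lemma SupportedOn.commute_clauseOp {T : Set V} {O : Operator V} (h : SupportedOn T O)
    {e : Sym2 V} (he : ∀ x ∈ e, x ∉ T) : Commute (clauseOp e) O :=
  commute_clauseOp_of_forall_mem fun j hj => (h j (he j hj)).2.symm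

lemma SupportedOn.heisenberg_mixerOp {T : Set V} {O : Operator V} (h : SupportedOn T O) (β : ℝ) :
    SupportedOn T (QAOA.heisenberg β (mixerOp V) O) := by
  rw [mixerOp, heisenberg_sum_eq_of_subset (filter_subset (· ∈ T) univ) commute_pauliX_pauliX
    fun j _ hj => (h j (by simpa using hj)).1.symm]
  exact (SupportedOn.sum fun j hj => supportedOn_pauliX (by simpa using hj)).heisenberg h β

lemma SupportedOn.heisenberg_costOp {T : Set V} {O : Operator V} (h : SupportedOn T O)
    (G : SimpleGraph V) (γ : ℝ) :
    SupportedOn (closedNbhd G T) (QAOA.heisenberg γ (costOp G) O) := by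
  rw [costOp, heisenberg_sum_eq_of_subset (filter_subset (fun e => ∃ x ∈ e, x ∈ T) _)
    commute_clauseOp_clauseOp fun e he he' => h.commute_clauseOp (by grind)]
  refine (SupportedOn.sum fun e he => supportedOn_clauseOp ?_).heisenberg
    (h.mono Set.subset_union_left) γ
  obtain ⟨heG, x, ⟨y, rfl⟩, hxT⟩ := mem_filter.1 he
  intro z hz
  obtain rfl | rfl := Sym2.mem_iff.1 hz
  · exact Or.inl hxT
  · exact Or.inr ⟨x, hxT, by simpa using heG⟩

lemma SupportedOn.layer {T : Set V} {O : Operator V} (h : SupportedOn T O) (G : SimpleGraph V)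
    (γ β : ℝ) : SupportedOn (closedNbhd G T) (layer G γ β O) :=
  (h.heisenberg_mixerOp β).heisenberg_costOp G γ

end Support

/-! ### Adding qubits on which an observable acts trivially -/

section Extend

open NormedSpace

variable {S V : Type*}

/-- A bit string on `V`, split into its restriction along `ι` and the remaining bits. -/
def splitEquiv (ι : S ↪ V) :
    (V → Bool) ≃ (S → Bool) × ({v // v ∉ Set.range ι} → Bool) :=
  (Equiv.piEquivPiSubtypeProd (· ∈ Set.range ι) fun _ => Bool).trans
    (((Equiv.ofInjective ι ι.injective).symm.arrowCongr (Equiv.refl _)).prodCongr (Equiv.refl _))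

lemma splitEquiv_apply (ι : S ↪ V) (z : V → Bool) :
    splitEquiv ι z = (z ∘ ι, fun v : {v // v ∉ Set.range ι} => z v) := rfl

lemma flipBit_comp_embedding (ι : S ↪ V) (x : S) (z : V → Bool) :
    flipBit (ι x) z ∘ ι = flipBit x (z ∘ ι) := by
  ext y
  simp [flipBit_apply]

lemma flipBit_comp_of_notMem_range (ι : S ↪ V) {v : V} (hv : v ∉ Set.range ι) (z : V → Bool) :
    flipBit v z ∘ ι = z ∘ ι := by
  ext x
  have hx : ι x ≠ v := ne_of_mem_of_not_mem (Set.mem_range_self x) hv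
  simp [flipBit_apply, hx]

variable [Fintype S] [Fintype V]

open scoped Kronecker in
/-- The operator on the qubits `V` that acts as `A` on the qubits `ι x` and trivially on the
others. -/
def extend (ι : S ↪ V) : Operator S →ₐ[ℂ] Operator V :=
  AlgHom.ofLinearMap
    { toFun := fun A => (A ⊗ₖ (1 : Matrix ({v // v ∉ Set.range ι} → Bool) _ ℂ)).submatrix
        (splitEquiv ι) (splitEquiv ι)
      map_add' := fun A B => by rw [Matrix.add_kronecker, Matrix.submatrix_add]; rfl
      map_smul' := fun c A => by rw [Matrix.smul_kronecker, Matrix.submatrix_smul]; rfl }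
    (by simp)
    (fun A B => by
      simp only [LinearMap.coe_mk, AddHom.coe_mk]
      rw [Matrix.submatrix_mul_equiv, ← Matrix.mul_kronecker_mul, one_mul])

lemma extend_eq_mul_one (ι : S ↪ V) (A : Operator S) (z w : V → Bool) :
    extend ι A z w = A (splitEquiv ι z).1 (splitEquiv ι w).1 *
      (1 : Matrix _ _ ℂ) (splitEquiv ι z).2 (splitEquiv ι w).2 := rfl

lemma extend_apply (ι : S ↪ V) (A : Operator S) (z w : V → Bool) :
    extend ι A z w = if ∀ v ∉ Set.range ι, z v = w v then A (z ∘ ι) (w ∘ ι) else 0 := by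
  rw [extend_eq_mul_one, Matrix.one_apply, mul_ite, mul_one, mul_zero]
  simp only [splitEquiv_apply, funext_iff, Subtype.forall]

open scoped Matrix.Norms.Operator in
lemma extend_exp (ι : S ↪ V) (A : Operator S) : extend ι (exp A) = exp (extend ι A) :=
  map_exp (extend ι) (LinearMap.continuous_of_finiteDimensional (extend ι).toLinearMap) A

lemma extend_heisenberg (ι : S ↪ V) (θ : ℝ) (A O : Operator S) :
    extend ι (heisenberg θ A O) = heisenberg θ (extend ι A) (extend ι O) := by
  simp only [heisenberg, propagator, map_mul, extend_exp, map_smul]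

lemma extend_pauliX (ι : S ↪ V) (x : S) : extend ι (pauliX x) = pauliX (ι x) := by
  have hrest (z : V → Bool) : ∀ v ∉ Set.range ι, flipBit (ι x) z v = z v := fun v hv => by
    rw [flipBit_apply, if_neg (ne_of_mem_of_not_mem (Set.mem_range_self x) hv).symm]
  ext z w
  rw [extend_apply, pauliX_apply, pauliX_apply, ← flipBit_comp_embedding, ← ite_and]
  refine if_congr ⟨fun ⟨hout, hin⟩ => (splitEquiv ι).injective (Prod.ext hin ?_), ?_⟩ rfl rfl
  · exact funext fun v => ((hrest z v v.2).trans (hout v v.2)).symm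
  · rintro rfl
    exact ⟨fun v hv => (hrest z v hv).symm, rfl⟩

lemma extend_pauliZ (ι : S ↪ V) (x : S) : extend ι (pauliZ x) = pauliZ (ι x) := by
  ext z w
  by_cases h : z = w
  · subst h
    simp [extend_apply, pauliZ]
  · have hsplit : ¬ ((∀ v ∉ Set.range ι, z v = w v) ∧ z ∘ ι = w ∘ ι) := fun h' =>
      h ((splitEquiv ι).injective (Prod.ext h'.2 (funext fun v => h'.1 v v.2)))
    rw [extend_apply, pauliZ, pauliZ, Matrix.diagonal_apply, Matrix.diagonal_apply, ← ite_and,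
      if_neg hsplit, if_neg h]

lemma extend_clauseOp (ι : S ↪ V) (e : Sym2 S) :
    extend ι (clauseOp e) = clauseOp (e.map ι) := by
  induction e with | _ j k
  simp only [Sym2.map_mk, clauseOp_mk, map_smul, map_sub, map_one, map_mul, extend_pauliZ]

lemma commute_extend_pauliX (ι : S ↪ V) {v : V} (hv : v ∉ Set.range ι) (A : Operator S) :
    Commute (extend ι A) (pauliX v) := by
  ext z w
  rw [pauliX_mul_apply, mul_pauliX_apply, extend_apply, extend_apply,
    flipBit_comp_of_notMem_range ι hv, flipBit_comp_of_notMem_range ι hv]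
  refine if_congr (forall₂_congr fun u _ => ?_) rfl rfl
  by_cases h : u = v
  · subst h
    simp [flipBit_apply, Bool.eq_not]
  · simp [flipBit_apply, h]

lemma commute_extend_pauliZ (ι : S ↪ V) {v : V} (hv : v ∉ Set.range ι) (A : Operator S) :
    Commute (extend ι A) (pauliZ v) := by
  ext z w
  rw [pauliZ, Matrix.diagonal_mul, Matrix.mul_diagonal, extend_apply]
  by_cases h : ∀ v ∉ Set.range ι, z v = w v
  · rw [h v hv, mul_comm]
  · rw [if_neg h, mul_zero, zero_mul]

lemma SupportedOn.extend (ι : S ↪ V) {T : Set S} {O : Operator S} (h : SupportedOn T O) :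
    SupportedOn (ι '' T) (extend ι O) := by
  intro v hv
  by_cases hr : v ∈ Set.range ι
  · obtain ⟨x, rfl⟩ := hr
    have hx := h x fun hxT => hv ⟨x, hxT, rfl⟩
    rw [← extend_pauliX, ← extend_pauliZ]
    exact ⟨hx.1.map (QAOA.extend ι), hx.2.map (QAOA.extend ι)⟩
  · exact ⟨commute_extend_pauliX ι hr O, commute_extend_pauliZ ι hr O⟩

lemma sum_extend (ι : S ↪ V) (A : Operator S) :
    ∑ z, ∑ w, extend ι A z w =
      Fintype.card ({v // v ∉ Set.range ι} → Bool) * ∑ z, ∑ w, A z w := by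
  rw [← (splitEquiv ι).symm.sum_comp]
  simp only [← (splitEquiv ι).symm.sum_comp (extend ι A _)]
  simp only [extend_eq_mul_one, Equiv.apply_symm_apply, Fintype.sum_prod_type, Matrix.one_apply,
    mul_ite, mul_one, mul_zero, sum_ite_eq, mem_univ, if_true, sum_const, card_univ, nsmul_eq_mul,
    mul_sum]

lemma expectation_extend_uniformState (ι : S ↪ V) (A : Operator S) :
    expectation (extend ι A) (uniformState V) = expectation A (uniformState S) := by
  rw [expectation_uniformState, expectation_uniformState, sum_extend,
    Fintype.card_congr (splitEquiv ι), Fintype.card_prod, Nat.cast_mul, mul_comm,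
    mul_div_mul_right _ _ (Nat.cast_ne_zero.2 Fintype.card_ne_zero)]

end Extend

/-! ### Locality -/

section Distance

variable {V W : Type*} {G : SimpleGraph V} {H : SimpleGraph W}

lemma edist_map_le (f : G →g H) (u v : V) : H.edist (f u) (f v) ≤ G.edist u v := by
  by_cases h : G.Reachable u v
  · obtain ⟨w, hw⟩ := h.exists_walk_length_eq_edist
    exact hw ▸ (w.map f).edist_le.trans_eq (by rw [SimpleGraph.Walk.length_map])
  · exact (SimpleGraph.edist_eq_top_of_not_reachable h).symm ▸ le_top

lemma edist_le_add_one_of_adj {u v : V} (h : G.Adj u v) (w : V) :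
    G.edist u w ≤ G.edist v w + 1 :=
  G.edist_triangle.trans_eq (by rw [SimpleGraph.edist_eq_one_iff_adj.2 h, add_comm])

lemma exists_edist_lt_succ_of_closedNbhd {T : Set V} {v : V} {p : ℕ}
    (h : ∃ w ∈ closedNbhd G T, G.edist w v < p) : ∃ w ∈ T, G.edist w v < (p + 1 : ℕ) := by
  have hp : (p : ℕ∞) < (p + 1 : ℕ) := by exact_mod_cast p.lt_succ_self
  obtain ⟨w, hw | ⟨x, hx, hxw⟩, hwv⟩ := h
  · exact ⟨w, hw, hwv.trans hp⟩
  · exact ⟨x, hx,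
      ((edist_le_add_one_of_adj hxw v).trans (Order.add_one_le_of_lt hwv)).trans_lt hp⟩

lemma apply_mem_iff_of_sym2_map_eq {f : V → W} (hf : f.Injective) {e : Sym2 V} {e' : Sym2 W}
    (he : e.map f = e') {v : V} : f v ∈ e' ↔ v ∈ e := by
  simp [← he, Sym2.mem_map, hf.eq_iff]

end Distance

section Locality

variable {S V : Type*} [Fintype S] [Fintype V]

lemma heisenberg_mixerOp_extend (ι : S ↪ V) (β : ℝ) (O : Operator S) :
    heisenberg β (mixerOp V) (extend ι O) = extend ι (heisenberg β (mixerOp S) O) := by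
  rw [extend_heisenberg, mixerOp, heisenberg_sum_eq_of_subset (subset_univ (univ.map ι))
    commute_pauliX_pauliX fun v _ hv => (commute_extend_pauliX ι (by simpa using hv) O).symm]
  simp only [sum_map, mixerOp, map_sum, extend_pauliX]

lemma heisenberg_costOp_extend {N : SimpleGraph S} {G : SimpleGraph V} (f : N.Copy G) {T : Set S}
    {O : Operator S} (hO : SupportedOn T O)
    (hcov : ∀ x ∈ T, G.neighborSet (f x) ⊆ f '' N.neighborSet x) (γ : ℝ) :
    heisenberg γ (costOp G) (extend f.toEmbedding O) =
      extend f.toEmbedding (heisenberg γ (costOp N) O) := by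
  have hsub : N.edgeFinset.map f.toEmbedding.sym2Map ⊆ G.edgeFinset := by
    intro e he
    obtain ⟨⟨x, y⟩, hxy, rfl⟩ := mem_map.1 he
    exact SimpleGraph.mem_edgeFinset.2 (f.toHom.map_adj (by simpa using hxy))
  have hout : ∀ e ∈ G.edgeFinset, e ∉ N.edgeFinset.map f.toEmbedding.sym2Map →
      ∀ v ∈ e, v ∉ f.toEmbedding '' T := by
    rintro e he hne _ ⟨u, rfl⟩ ⟨x, hx, rfl⟩
    obtain ⟨y, hxy, rfl⟩ := hcov x hx (SimpleGraph.mem_edgeFinset.1 he)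
    exact hne (mem_map.2 ⟨s(x, y), SimpleGraph.mem_edgeFinset.2 hxy, rfl⟩)
  rw [extend_heisenberg, costOp, heisenberg_sum_eq_of_subset hsub commute_clauseOp_clauseOp
    fun e he hne => (hO.extend f.toEmbedding).commute_clauseOp (hout e he hne)]
  simp only [sum_map, costOp, map_sum, extend_clauseOp]
  rfl

/-- The light cone of `O`: each layer of the circuit enlarges its support by one step, so after `p`
layers only the edges with an end at distance less than `p` from the support have been used. -/
lemma expectation_extend_state {N : SimpleGraph S} {G : SimpleGraph V} (f : N.Copy G) :
    ∀ {p : ℕ} (γ β : Fin p → ℝ) {T : Set S} {O : Operator S}, SupportedOn T O →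
      (∀ x, (∃ w ∈ T, N.edist w x < p) → G.neighborSet (f x) ⊆ f '' N.neighborSet x) →
      expectation (extend f.toEmbedding O) (state G p γ β) = expectation O (state N p γ β)
  | 0, _, _, _, O, _, _ => expectation_extend_uniformState f.toEmbedding O
  | p + 1, γ, β, T, O, hO, hcov => by
    have hcovT : ∀ x ∈ T, G.neighborSet (f x) ⊆ f '' N.neighborSet x :=
      fun x hx => hcov x ⟨x, hx, by simp⟩
    rw [expectation_state_succ, expectation_state_succ,
      ← expectation_extend_state f _ _ (hO.layer N _ _)
        fun x hx => hcov x (exists_edist_lt_succ_of_closedNbhd hx),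
      layer, layer, heisenberg_mixerOp_extend,
      heisenberg_costOp_extend f (hO.heisenberg_mixerOp _) hcovT]

theorem edgeTerm_map {N : SimpleGraph S} {G : SimpleGraph V} (f : N.Copy G) (e : Sym2 S) {p : ℕ}
    (hcov : ∀ x, (∃ w ∈ e, N.edist w x < p) → G.neighborSet (f x) ⊆ f '' N.neighborSet x)
    (γ β : Fin p → ℝ) : edgeTerm G (e.map f) γ β = edgeTerm N e γ β := by
  rw [edgeTerm, edgeTerm, ← expectation_extend_state f γ β (T := {x | x ∈ e})
    (supportedOn_clauseOp fun _ hx => hx) hcov, extend_clauseOp]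
  rfl

lemma edgeTerm_iso {N : SimpleGraph S} {G : SimpleGraph V} (φ : N ≃g G) (e : Sym2 S) {p : ℕ}
    (γ β : Fin p → ℝ) : edgeTerm G (e.map φ) γ β = edgeTerm N e γ β :=
  edgeTerm_map φ.toCopy e (fun x _ v hv => ⟨φ.symm v, φ.map_adj_iff.1 (by simpa using hv), by simp⟩)
    γ β

lemma edgeTerm_edgeNbhd (G : SimpleGraph V) (p : ℕ) {e : Sym2 V}
    (e' : Sym2 (edgeNbhd G e p).verts) (he : e'.map Subtype.val = e) (γ β : Fin p → ℝ) :
    edgeTerm (edgeNbhd G e p).coe e' γ β = edgeTerm G e γ β := by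
  have hcov : ∀ x, (∃ w ∈ e', (edgeNbhd G e p).coe.edist w x < p) →
      G.neighborSet x ⊆ Subtype.val '' (edgeNbhd G e p).coe.neighborSet x := by
    rintro x ⟨w, hw, hwx⟩ v hv
    have hwe : w.1 ∈ e := (apply_mem_iff_of_sym2_map_eq Subtype.val_injective he).2 hw
    have hxv : (edgeNbhd G e p).Adj x v :=
      ⟨hv, Or.inr (Or.inl ⟨w, hwe, (edist_map_le (edgeNbhd G e p).hom w x).trans_lt hwx⟩)⟩
    exact ⟨⟨v, (edgeNbhd G e p).edge_vert hxv.symm⟩, hxv, rfl⟩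
  conv_rhs => rw [← he]
  exact (edgeTerm_map (edgeNbhd G e p).coeCopy e' hcov γ β).symm

lemma exists_map_val_eq_of_edgeNbhd {V : Type*} (G : SimpleGraph V) (e : Sym2 V) (p : ℕ) :
    ∃ e' : Sym2 (edgeNbhd G e p).verts, e'.map Subtype.val = e := by
  induction e with | _ x y
  exact ⟨s(⟨x, x, by simp, by simp⟩, ⟨y, y, by simp, by simp⟩), rfl⟩

theorem edgeTerm_eq_of_sameNbhd {W : Type*} [Fintype W] {G : SimpleGraph V} {H : SimpleGraph W}
    {e : Sym2 V} {f : Sym2 W} {p : ℕ} (h : SameNbhd G e H f p) (γ β : Fin p → ℝ) :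
    edgeTerm G e γ β = edgeTerm H f γ β := by
  obtain ⟨φ, hφ⟩ := h
  obtain ⟨e', he⟩ := exists_map_val_eq_of_edgeNbhd G e p
  obtain ⟨f', hf⟩ := exists_map_val_eq_of_edgeNbhd H f p
  have hef : e'.map φ = f' := by
    ext v
    obtain ⟨u, rfl⟩ := φ.surjective v
    rw [apply_mem_iff_of_sym2_map_eq φ.injective rfl,
      ← apply_mem_iff_of_sym2_map_eq Subtype.val_injective he, hφ u,
      apply_mem_iff_of_sym2_map_eq Subtype.val_injective hf]
  rw [← edgeTerm_edgeNbhd G p e' he, ← edgeTerm_edgeNbhd H p f' hf, ← hef, edgeTerm_iso]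

end Locality

/-! ### The tree cover -/

section Trees

variable {A B : Type*} {G : SimpleGraph A} {T : SimpleGraph B}

lemma isChain_edges_map (f : G →g T)
    (hf : ∀ z u v, G.Adj z u → G.Adj z v → f u = f v → u = v) {x y : A} (w : G.Walk x y)
    (hw : w.edges.IsChain (· ≠ ·)) : (w.map f).edges.IsChain (· ≠ ·) := by
  induction w with
  | nil => exact List.isChain_nil
  | cons h q ih =>
    cases q with
    | nil => exact List.isChain_singleton _
    | cons h' q =>
      simp only [SimpleGraph.Walk.edges_cons, SimpleGraph.Walk.map_cons,
        List.isChain_cons_cons] at hw ih ⊢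
      refine ⟨fun he => hw.1 ?_, ih hw.2⟩
      obtain ⟨hback, -⟩ | ⟨hturn, -⟩ := Sym2.eq_iff.1 he
      · exact absurd hback (f.map_adj h).ne
      · rw [hf _ _ _ h.symm h' hturn, Sym2.eq_swap]

/-- The image of a path is a walk without backtracking, and such a walk in a tree is a path. -/
theorem injective_of_locally_injective (hG : G.Preconnected) (hT : T.IsAcyclic) (f : G →g T)
    (hf : ∀ z u v, G.Adj z u → G.Adj z v → f u = f v → u = v) : Function.Injective f := by
  intro x y hxy
  obtain ⟨w, hw⟩ := (hG x y).exists_isPath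
  have hpath : ((w.map f).copy rfl hxy.symm).IsPath := by
    rw [SimpleGraph.Walk.isPath_copy, hT.isPath_iff_isChain]
    exact isChain_edges_map f hf w (List.Pairwise.isChain hw.isTrail.edges_nodup)
  rw [SimpleGraph.Walk.isPath_iff_nil, ← SimpleGraph.Walk.length_eq_zero_iff,
    SimpleGraph.Walk.length_copy, SimpleGraph.Walk.length_map] at hpath
  exact SimpleGraph.Walk.eq_of_length_eq_zero hpath

lemma le_add_edist_of_forall_adj {f : A → ℕ} (hf : ∀ u v, G.Adj u v → f v ≤ f u + 1) (u v : A) :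
    (f v : ℕ∞) ≤ f u + G.edist u v := by
  have hwalk {u v : A} (w : G.Walk u v) : f v ≤ f u + w.length := by
    induction w with
    | nil => simp
    | cons h q ih => grind [SimpleGraph.Walk.length_cons]
  by_cases h : G.Reachable u v
  · obtain ⟨w, hw⟩ := h.exists_walk_length_eq_edist
    rw [← hw]
    exact_mod_cast hwalk w
  · simp [SimpleGraph.edist_eq_top_of_not_reachable h]

end Trees

section EdgeTree

variable {p : ℕ}

/-- The parent of a vertex of the tree. The endpoints of the central edge count as parents of each
other, so that every vertex has a parent. -/
def treeParent : TreeVertex p → TreeVertex p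
  | (s, ⟨[], h⟩) => (!s, ⟨[], h⟩)
  | (s, ⟨_ :: l, h⟩) => (s, ⟨l, (Nat.le_succ _).trans h⟩)

/-- The children of a vertex of the tree that is not a leaf. -/
def treeChild (z : TreeVertex p) (hz : z.2.1.length < p) (b : Bool) : TreeVertex p :=
  (z.1, ⟨b :: z.2.1, hz⟩)

lemma edgeTree_adj_treeParent (z : TreeVertex p) : (edgeTree p).Adj z (treeParent z) := by
  obtain ⟨s, _ | ⟨b, l⟩, hl⟩ := z
  · cases s <;> simp [edgeTree, SimpleGraph.fromRel_adj, treeParent]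
  · simp [edgeTree, SimpleGraph.fromRel_adj, treeParent]

lemma edgeTree_adj_treeChild (z : TreeVertex p) (hz : z.2.1.length < p) (b : Bool) :
    (edgeTree p).Adj z (treeChild z hz b) :=
  (edgeTree_adj_treeParent (treeChild z hz b)).symm

lemma eq_treeParent_or_eq_treeChild {z w : TreeVertex p} (h : (edgeTree p).Adj z w) :
    w = treeParent z ∨ ∃ hz b, w = treeChild z hz b := by
  obtain ⟨s, l, hl⟩ := z
  obtain ⟨t, m, hm⟩ := w
  obtain ⟨-, (⟨rfl, rfl, hst⟩ | ⟨rfl, b, rfl⟩) | (⟨rfl, rfl, hst⟩ | ⟨rfl, b, rfl⟩)⟩ :=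
    (SimpleGraph.fromRel_adj _ _ _).1 h
  · exact Or.inl (by rw [treeParent, ← Bool.eq_not.2 (Ne.symm hst)])
  · exact Or.inr ⟨hm, b, rfl⟩
  · exact Or.inl (by rw [treeParent, ← Bool.eq_not.2 hst])
  · exact Or.inl rfl

lemma length_le_length_add_one_of_edgeTree_adj {z w : TreeVertex p} (h : (edgeTree p).Adj z w) :
    w.2.1.length ≤ z.2.1.length + 1 := by
  obtain rfl | ⟨_, _, rfl⟩ := eq_treeParent_or_eq_treeChild h
  · obtain ⟨s, _ | ⟨b, l⟩, hl⟩ := z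
    · exact Nat.zero_le _
    · exact (Nat.le_succ _).trans (Nat.le_succ _)
  · exact le_rfl

lemma length_le_edist_of_mem_centralEdge {z w : TreeVertex p} (hz : z ∈ centralEdge p) :
    (w.2.1.length : ℕ∞) ≤ (edgeTree p).edist z w := by
  have hroot : z.2.1.length = 0 := by
    obtain rfl | rfl := Sym2.mem_iff.1 hz <;> rfl
  simpa [hroot] using le_add_edist_of_forall_adj (f := fun z : TreeVertex p => z.2.1.length)
    (fun _ _ => length_le_length_add_one_of_edgeTree_adj) z w

lemma edgeTree_reachable_root (s : Bool) : ∀ (l : List Bool) (hl : l.length ≤ p),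
    (edgeTree p).Reachable (s, ⟨l, hl⟩) (false, ⟨[], Nat.zero_le p⟩)
  | [], hl => by
    cases s
    · exact SimpleGraph.Reachable.refl _
    · exact (edgeTree_adj_treeParent (true, ⟨[], hl⟩)).reachable
  | b :: l, hl =>
    (edgeTree_adj_treeParent (s, ⟨b :: l, hl⟩)).reachable.trans (edgeTree_reachable_root s l _)

lemma edgeTree_preconnected (p : ℕ) : (edgeTree p).Preconnected := fun z w =>
  (edgeTree_reachable_root z.1 _ z.2.2).trans (edgeTree_reachable_root w.1 _ w.2.2).symm

end EdgeTree

section TreeCover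

variable {V : Type*} {G : SimpleGraph V} [G.LocallyFinite]

/-- An enumeration of the two neighbors, other than `d.snd`, of the vertex `d.fst` of a cubic
graph. -/
def childEquiv (hG : G.IsRegularOfDegree 3) (d : G.Dart) :
    Bool ≃ (G.neighborFinset d.fst).erase d.snd :=
  Fintype.equivOfCardEq <| by
    rw [Fintype.card_bool, Fintype.card_coe,
      card_erase_of_mem ((G.mem_neighborFinset _ _).2 d.adj), G.card_neighborFinset_eq_degree,
      hG d.fst]

/-- The darts that continue the dart `d`, read as a vertex `d.fst` with its parent `d.snd`, to the
children of `d.fst`. -/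
def childDart (hG : G.IsRegularOfDegree 3) (d : G.Dart) (b : Bool) : G.Dart where
  toProd := (childEquiv hG d b, d.fst)
  adj := ((G.mem_neighborFinset _ _).1 (mem_of_mem_erase (childEquiv hG d b).2)).symm

/-- The dart reached from `d` by descending along a path of binary choices, the most recent choice
first. -/
def descend (hG : G.IsRegularOfDegree 3) (d : G.Dart) (l : List Bool) : G.Dart :=
  l.foldr (fun b d' => childDart hG d' b) d

/-- The universal cover of a cubic graph around the edge of the dart `d`, truncated at depth `p`:
the first component of `treeCover hG d z` is the image of `z`, the second that of its parent. -/
def treeCover (hG : G.IsRegularOfDegree 3) (d : G.Dart) {p : ℕ} (z : TreeVertex p) : G.Dart :=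
  descend hG (bif z.1 then d.symm else d) z.2.1

variable (hG : G.IsRegularOfDegree 3) (d : G.Dart) {p : ℕ}

lemma childDart_fst_ne_snd (b : Bool) : (childDart hG d b).fst ≠ d.snd :=
  ne_of_mem_erase (childEquiv hG d b).2

lemma childDart_fst_injective : Function.Injective fun b => (childDart hG d b).fst :=
  Subtype.val_injective.comp (childEquiv hG d).injective

lemma exists_childDart_fst_eq {w : V} (hw : G.Adj d.fst w) (hne : w ≠ d.snd) :
    ∃ b, (childDart hG d b).fst = w := by
  obtain ⟨b, hb⟩ := (childEquiv hG d).surjective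
    ⟨w, mem_erase.2 ⟨hne, (G.mem_neighborFinset _ _).2 hw⟩⟩
  exact ⟨b, congrArg Subtype.val hb⟩

lemma edist_descend_le : ∀ l, G.edist d.fst (descend hG d l).fst ≤ l.length
  | [] => by simp [descend]
  | b :: l => by
    have hadj : G.Adj (descend hG d l).fst (descend hG d (b :: l)).fst :=
      (descend hG d (b :: l)).adj.symm
    calc G.edist d.fst (descend hG d (b :: l)).fst
        ≤ G.edist d.fst (descend hG d l).fst + 1 := by
          simpa only [G.edist_comm (u := d.fst)] using edist_le_add_one_of_adj hadj.symm d.fst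
      _ ≤ (b :: l).length := by
          simpa using add_le_add_left (edist_descend_le l) 1

lemma treeCover_treeParent_fst (z : TreeVertex p) :
    (treeCover hG d (treeParent z)).fst = (treeCover hG d z).snd := by
  obtain ⟨s, _ | ⟨b, l⟩, hl⟩ := z
  · cases s <;> rfl
  · rfl

lemma exists_edist_treeCover_le (z : TreeVertex p) :
    ∃ w ∈ d.edge, G.edist w (treeCover hG d z).fst ≤ z.2.1.length := by
  refine ⟨_, ?_, edist_descend_le hG (bif z.1 then d.symm else d) z.2.1⟩
  cases z.1
  · exact Sym2.mem_mk_left _ _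
  · exact Sym2.mem_mk_right _ _

lemma edgeNbhd_adj_treeCover (z : TreeVertex p) :
    (edgeNbhd G d.edge p).Adj (treeCover hG d z).fst (treeCover hG d z).snd := by
  refine ⟨(treeCover hG d z).adj, ?_⟩
  obtain ⟨s, _ | ⟨b, l⟩, hl⟩ := z
  · left
    cases s
    · rfl
    · exact d.edge_symm
  · obtain ⟨w, hw, hwl⟩ :=
      exists_edist_treeCover_le hG d (p := p) (s, ⟨l, (Nat.le_succ _).trans hl⟩)
    exact Or.inr (Or.inr ⟨w, hw, hwl.trans_lt (by exact_mod_cast hl)⟩)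

lemma edgeNbhd_adj_treeCover_of_adj {z w : TreeVertex p} (h : (edgeTree p).Adj z w) :
    (edgeNbhd G d.edge p).Adj (treeCover hG d z).fst (treeCover hG d w).fst := by
  obtain rfl | ⟨hz, b, rfl⟩ := eq_treeParent_or_eq_treeChild h
  · rw [treeCover_treeParent_fst]
    exact edgeNbhd_adj_treeCover hG d z
  · exact (edgeNbhd_adj_treeCover hG d (treeChild z hz b)).symm

lemma treeCover_locally_injective {z u w : TreeVertex p} (hu : (edgeTree p).Adj z u)
    (hw : (edgeTree p).Adj z w) (h : (treeCover hG d u).fst = (treeCover hG d w).fst) : u = w := by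
  obtain rfl | ⟨hz, b, rfl⟩ := eq_treeParent_or_eq_treeChild hu <;>
    obtain rfl | ⟨hz, c, rfl⟩ := eq_treeParent_or_eq_treeChild hw
  · rfl
  · rw [treeCover_treeParent_fst] at h
    exact absurd h.symm (childDart_fst_ne_snd hG _ c)
  · rw [treeCover_treeParent_fst] at h
    exact absurd h (childDart_fst_ne_snd hG _ b)
  · rw [childDart_fst_injective hG (treeCover hG d z) h]

lemma neighborSet_treeCover_subset {z : TreeVertex p} (hz : z.2.1.length < p) :
    G.neighborSet (treeCover hG d z).fst ⊆
      (fun w => (treeCover hG d w).fst) '' (edgeTree p).neighborSet z := by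
  intro v hv
  by_cases hvz : v = (treeCover hG d z).snd
  · exact ⟨treeParent z, edgeTree_adj_treeParent z,
      (treeCover_treeParent_fst hG d z).trans hvz.symm⟩
  · obtain ⟨b, hb⟩ := exists_childDart_fst_eq hG _ hv hvz
    exact ⟨treeChild z hz b, edgeTree_adj_treeChild z hz b, hb⟩

/-- The tree cover as a homomorphism to the neighborhood of the edge of `d`. -/
def treeCoverHom (p : ℕ) : edgeTree p →g (edgeNbhd G d.edge p).coe where
  toFun z := ⟨(treeCover hG d z).fst,
    (edgeNbhd G d.edge p).edge_vert (edgeNbhd_adj_treeCover hG d z)⟩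
  map_rel' h := edgeNbhd_adj_treeCover_of_adj hG d h

lemma treeCoverHom_injective (ht : IsTreeLike G d.edge p) :
    Function.Injective (treeCoverHom hG d p) :=
  injective_of_locally_injective (edgeTree_preconnected p) ht.isAcyclic _
    fun _ _ _ hu hw h => treeCover_locally_injective hG d hu hw (congrArg Subtype.val h)

theorem edgeTerm_eq_treeTerm [Fintype V] (hG : G.IsRegularOfDegree 3) {e : Sym2 V}
    (he : e ∈ G.edgeSet) (ht : IsTreeLike G e p) (γ β : Fin p → ℝ) :
    edgeTerm G e γ β = treeTerm γ β := by
  induction e with | _ x y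
  let d : G.Dart := ⟨(x, y), he⟩
  exact edgeTerm_map ((edgeNbhd G d.edge p).coeCopy.comp
      ((treeCoverHom hG d p).toCopy (treeCoverHom_injective hG d ht))) (centralEdge p)
    (fun z ⟨w, hw, hwz⟩ => neighborSet_treeCover_subset hG d
      (by exact_mod_cast (length_le_edist_of_mem_centralEdge hw).trans_lt hwz)) γ β

end TreeCover

section ObjectivePerEdge

variable {V : Type*} [Fintype V] {G : SimpleGraph V}

lemma two_mul_card_edgeFinset {d : ℕ} (hG : G.IsRegularOfDegree d) :
    2 * #G.edgeFinset = d * Fintype.card V := by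
  rw [← G.sum_degrees_eq_twice_card_edges, sum_congr rfl fun v _ => hG v]
  simp [mul_comm]

lemma abs_edgeTerm_sub_treeTerm_le (G : SimpleGraph V) (e : Sym2 V) {p : ℕ} (γ β : Fin p → ℝ) :
    |edgeTerm G e γ β - treeTerm γ β| ≤ 1 :=
  Real.dist_le_of_mem_Icc_01 (edgeTerm_mem_Icc G e γ β)
    (edgeTerm_mem_Icc (edgeTree p) (centralEdge p) γ β)

lemma objectivePerEdge_sub_treeTerm (hG : G.edgeFinset.Nonempty) {p : ℕ} (γ β : Fin p → ℝ) :
    objectivePerEdge G γ β - treeTerm γ β =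
      (∑ e ∈ G.edgeFinset, (edgeTerm G e γ β - treeTerm γ β)) / #G.edgeFinset := by
  have hm : (#G.edgeFinset : ℝ) ≠ 0 := by simpa using hG.ne_empty
  rw [objectivePerEdge, objective_eq_sum_edgeTerm, sum_sub_distrib, sum_const, nsmul_eq_mul,
    sub_div, mul_div_cancel_left₀ _ hm]

theorem abs_objectivePerEdge_sub_treeTerm_le [Nonempty V] (hG : G.IsRegularOfDegree 3) {p : ℕ}
    (γ β : Fin p → ℝ) :
    |objectivePerEdge G γ β - treeTerm γ β| ≤ nonTreeFraction G p := by
  have hm : G.edgeFinset.Nonempty := by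
    have hcard := two_mul_card_edgeFinset hG
    have hV := Fintype.card_pos (α := V)
    exact card_pos.1 (by omega)
  rw [objectivePerEdge_sub_treeTerm hm, abs_div, Nat.abs_cast, nonTreeFraction]
  gcongr
  refine (abs_sum_le_sum_abs _ _).trans ?_
  rw [card_filter, Nat.cast_sum]
  refine sum_le_sum fun e he => ?_
  split_ifs with ht
  · rw [edgeTerm_eq_treeTerm hG (SimpleGraph.mem_edgeFinset.1 he) ht]
    simp
  · simpa using abs_edgeTerm_sub_treeTerm_le G e γ β

end ObjectivePerEdge

/-! ### Short cycles -/

section EdgeNbhdConnected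

variable {V : Type*} {G : SimpleGraph V} {e : Sym2 V} {p : ℕ}

lemma exists_walk_length_le_of_edist_le {u v : V} {r : ℕ} (h : G.edist u v ≤ r) :
    ∃ w : G.Walk u v, w.length ≤ r := by
  obtain ⟨w, hw⟩ := SimpleGraph.exists_walk_of_edist_ne_top (ne_top_of_le_ne_top (by simp) h)
  exact ⟨w, by exact_mod_cast hw.le.trans h⟩

lemma edgeNbhd_reachable_of_walk {u v : V} (hu : u ∈ e) (w : G.Walk v u) (hw : w.length ≤ p)
    (hv : v ∈ (edgeNbhd G e p).verts) :
    (edgeNbhd G e p).coe.Reachable ⟨v, hv⟩ ⟨u, u, hu, by simp⟩ := by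
  induction w with
  | nil => exact SimpleGraph.Reachable.refl _
  | @cons v x u hvx w ih =>
    rw [SimpleGraph.Walk.length_cons] at hw
    have hux : G.edist u x < p :=
      (G.edist_comm.trans_le w.edist_le).trans_lt (by exact_mod_cast hw)
    have hadj : (edgeNbhd G e p).Adj v x := ⟨hvx, Or.inr (Or.inr ⟨u, hu, hux⟩)⟩
    exact (SimpleGraph.Subgraph.Adj.coe hadj).reachable.trans
      (ih hu (by omega) ((edgeNbhd G e p).edge_vert hadj.symm))

lemma edgeNbhd_connected (he : e ∈ G.edgeSet) (p : ℕ) : (edgeNbhd G e p).coe.Connected := by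
  induction e with | _ x y
  have hxy : (edgeNbhd G s(x, y) p).Adj x y := ⟨he, Or.inl rfl⟩
  refine (SimpleGraph.connected_iff_exists_forall_reachable _).2
    ⟨⟨x, (edgeNbhd G s(x, y) p).edge_vert hxy⟩, fun ⟨v, u, hu, hvu⟩ => ?_⟩
  obtain ⟨w, hw⟩ := exists_walk_length_le_of_edist_le hvu
  have hreach := edgeNbhd_reachable_of_walk (p := p) hu w.reverse (by simpa) ⟨u, hu, hvu⟩
  obtain rfl | rfl := Sym2.mem_iff.1 hu
  · exact hreach.symm
  · exact (SimpleGraph.Subgraph.Adj.coe hxy).reachable.trans hreach.symm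

end EdgeNbhdConnected

section ShortCycleEdge

variable {V W : Type*} {G : SimpleGraph V} {H : SimpleGraph W} {L : ℕ}

/-- The edge `xy` lies on a cycle of length at most `L + 1`, that is, its ends stay at distance at
most `L` when it is deleted. -/
def IsShortCycleEdge (G : SimpleGraph V) (L : ℕ) (x y : V) : Prop :=
  G.Adj x y ∧ (G.deleteEdges {s(x, y)}).edist x y ≤ L

lemma IsShortCycleEdge.map (f : G.Copy H) {x y : V} (h : IsShortCycleEdge G L x y) :
    IsShortCycleEdge H L (f x) (f y) := by
  let f' : G.deleteEdges {s(x, y)} →g H.deleteEdges {s(f x, f y)} :=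
    { toFun := f
      map_rel' := fun {u v} huv => by
        rw [SimpleGraph.deleteEdges_adj] at huv ⊢
        refine ⟨f.toHom.map_adj huv.1, fun hfuv => huv.2 ?_⟩
        exact Sym2.map.injective f.injective hfuv }
  exact ⟨f.toHom.map_adj h.1, (edist_map_le f' x y).trans h.2⟩

lemma exists_isShortCycleEdge_of_not_isAcyclic [Fintype V] (h : ¬ G.IsAcyclic) :
    ∃ x y, IsShortCycleEdge G (Fintype.card V) x y := by
  simp only [SimpleGraph.isAcyclic_iff_forall_adj_isBridge, SimpleGraph.isBridge_iff, not_forall,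
    not_not] at h
  obtain ⟨x, y, hxy, hreach⟩ := h
  obtain ⟨w, hw⟩ := hreach.exists_isPath
  exact ⟨x, y, hxy, w.edist_le.trans (by exact_mod_cast hw.length_lt.le)⟩

lemma IsShortCycleEdge.mono {M : ℕ} {x y : V} (h : IsShortCycleEdge G L x y) (hLM : L ≤ M) :
    IsShortCycleEdge G M x y :=
  ⟨h.1, h.2.trans (by exact_mod_cast hLM)⟩

end ShortCycleEdge

section Balls

variable {V : Type*} [Fintype V] {G : SimpleGraph V} {d : ℕ}

/-- The vertices at distance at most `r` from `x`. -/
def closedBall (G : SimpleGraph V) (x : V) (r : ℕ) : Finset V :=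
  {v | G.edist x v ≤ r}

lemma mem_closedBall {x v : V} {r : ℕ} : v ∈ closedBall G x r ↔ G.edist x v ≤ r := by
  simp [closedBall]

lemma closedBall_succ_subset (G : SimpleGraph V) (x : V) (r : ℕ) :
    closedBall G x (r + 1) ⊆
      (closedBall G x r).biUnion fun u => insert u (G.neighborFinset u) := by
  intro v hv
  rw [mem_closedBall, G.edist_comm] at hv
  obtain ⟨w, hw⟩ := exists_walk_length_le_of_edist_le hv
  rw [mem_biUnion]
  cases w with
  | nil => exact ⟨x, mem_closedBall.2 (by simp), mem_insert_self _ _⟩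
  | @cons _ u _ hvu w =>
    refine ⟨u, mem_closedBall.2 ?_, mem_insert_of_mem ((G.mem_neighborFinset _ _).2 hvu.symm)⟩
    rw [G.edist_comm]
    exact w.edist_le.trans (by exact_mod_cast Nat.le_of_succ_le_succ hw)

lemma card_closedBall_le (hd : ∀ v, G.degree v ≤ d) (x : V) :
    ∀ r, #(closedBall G x r) ≤ (d + 1) ^ r
  | 0 => card_le_one.2 fun u hu v hv => by
    simp only [mem_closedBall, Nat.cast_zero, nonpos_iff_eq_zero,
      SimpleGraph.edist_eq_zero_iff] at hu hv
    exact hu.symm.trans hv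
  | r + 1 => by
    have hinsert (u : V) : #(insert u (G.neighborFinset u)) ≤ d + 1 :=
      (card_insert_le _ _).trans
        (Nat.succ_le_succ ((G.card_neighborFinset_eq_degree u).trans_le (hd u)))
    calc #(closedBall G x (r + 1))
        ≤ #(closedBall G x r) * (d + 1) :=
          (card_le_card (closedBall_succ_subset G x r)).trans
            (card_biUnion_le_card_mul _ _ _ fun u _ => hinsert u)
      _ ≤ (d + 1) ^ r * (d + 1) := Nat.mul_le_mul_right _ (card_closedBall_le hd x r)
      _ = (d + 1) ^ (r + 1) := (pow_succ _ _).symm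

/-- A bound for the number of vertices of the radius `p` neighborhood of an edge, and hence for the
length of its cycles, in a graph of maximal degree at most `d`. -/
def nbhdBound (d p : ℕ) : ℕ := 2 * (d + 1) ^ p

lemma card_edgeNbhd_verts_le (hd : ∀ v, G.degree v ≤ d) (e : Sym2 V) (p : ℕ) :
    Fintype.card (edgeNbhd G e p).verts ≤ nbhdBound d p := by
  induction e with | _ x y
  have hsub : (edgeNbhd G s(x, y) p).verts.toFinset ⊆ closedBall G x p ∪ closedBall G y p := by
    intro v hv
    obtain ⟨w, hw, hwv⟩ := Set.mem_toFinset.1 hv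
    obtain rfl | rfl := Sym2.mem_iff.1 hw
    · exact mem_union_left _ (mem_closedBall.2 hwv)
    · exact mem_union_right _ (mem_closedBall.2 hwv)
  calc Fintype.card (edgeNbhd G s(x, y) p).verts
      = #(edgeNbhd G s(x, y) p).verts.toFinset := (Set.toFinset_card _).symm
    _ ≤ #(closedBall G x p) + #(closedBall G y p) :=
      (card_le_card hsub).trans (card_union_le _ _)
    _ ≤ nbhdBound d p := by
      rw [nbhdBound, two_mul]
      exact add_le_add (card_closedBall_le hd x p) (card_closedBall_le hd y p)

end Balls

section NonTreeEdges

variable {V : Type*} [Fintype V] {G : SimpleGraph V} {d : ℕ}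

/-- The ordered pairs of ends of the edges of `G` on cycles of length at most `L + 1`. -/
def shortCycleDarts (G : SimpleGraph V) (L : ℕ) : Finset (V × V) :=
  {q | IsShortCycleEdge G L q.1 q.2}

lemma exists_isShortCycleEdge_of_not_isTreeLike (hd : ∀ v, G.degree v ≤ d) {e : Sym2 V}
    (he : e ∈ G.edgeSet) {p : ℕ} (h : ¬ IsTreeLike G e p) :
    ∃ x y, IsShortCycleEdge G (nbhdBound d p) x y ∧ ∃ w ∈ e, G.edist x w ≤ p := by
  have hcyc : ¬ (edgeNbhd G e p).coe.IsAcyclic := fun hac => h ⟨edgeNbhd_connected he p, hac⟩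
  obtain ⟨x, y, hxy⟩ := exists_isShortCycleEdge_of_not_isAcyclic hcyc
  obtain ⟨w, hw, hwx⟩ := x.2
  exact ⟨x, y, (hxy.map (edgeNbhd G e p).coeCopy).mono (card_edgeNbhd_verts_le hd e p), w, hw,
    G.edist_comm.trans_le hwx⟩

lemma card_not_isTreeLike_le (hd : ∀ v, G.degree v ≤ d) (p : ℕ) :
    #{e ∈ G.edgeFinset | ¬ IsTreeLike G e p} ≤
      #(shortCycleDarts G (nbhdBound d p)) * ((d + 1) ^ p * d) := by
  have hsub : {e ∈ G.edgeFinset | ¬ IsTreeLike G e p} ⊆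
      (shortCycleDarts G (nbhdBound d p)).biUnion fun q =>
        (closedBall G q.1 p).biUnion fun w => G.incidenceFinset w := by
    intro e he
    obtain ⟨he, ht⟩ := mem_filter.1 he
    have he' : e ∈ G.edgeSet := SimpleGraph.mem_edgeFinset.1 he
    obtain ⟨x, y, hxy, w, hw, hxw⟩ := exists_isShortCycleEdge_of_not_isTreeLike hd he' ht
    exact mem_biUnion.2 ⟨(x, y), mem_filter.2 ⟨mem_univ _, hxy⟩,
      mem_biUnion.2 ⟨w, mem_closedBall.2 hxw, (G.mem_incidenceFinset _ _).2 ⟨he', hw⟩⟩⟩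
  refine (card_le_card hsub).trans (card_biUnion_le_card_mul _ _ _ fun q _ => ?_)
  refine (card_biUnion_le_card_mul _ _ d fun w _ => ?_).trans
    (Nat.mul_le_mul_right _ (card_closedBall_le hd _ _))
  exact (G.card_incidenceFinset_eq_degree w).trans_le (hd w)

end NonTreeEdges

/-! ### Switching -/

section Switch

variable {V : Type*} {G : SimpleGraph V} {x y a b : V}

/-- The switching that replaces the edges `xy` and `ab` by `xa` and `yb`. -/
def switch (G : SimpleGraph V) (x y a b : V) : SimpleGraph V :=
  G.deleteEdges {s(x, y), s(a, b)} ⊔ SimpleGraph.fromEdgeSet {s(x, a), s(y, b)}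

/-- The condition under which switching at `xy` and `ab` preserves degrees and can be undone: these
are disjoint edges, and the new edges `xa` and `yb` are not yet present. -/
structure Switchable (G : SimpleGraph V) (x y a b : V) : Prop where
  adj_left : G.Adj x y
  adj_right : G.Adj a b
  ne_xa : x ≠ a
  ne_xb : x ≠ b
  ne_ya : y ≠ a
  ne_yb : y ≠ b
  not_adj_xa : ¬ G.Adj x a
  not_adj_yb : ¬ G.Adj y b

lemma switch_reverse (G : SimpleGraph V) (x y a b : V) : switch G x y a b = switch G y x b a := by
  simp only [switch, Sym2.eq_swap (a := x) (b := y), Sym2.eq_swap (a := a) (b := b),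
    Set.pair_comm s(x, a)]

lemma switch_swap (G : SimpleGraph V) (x y a b : V) : switch G x y a b = switch G a b x y := by
  simp only [switch, Sym2.eq_swap (a := x) (b := a), Sym2.eq_swap (a := y) (b := b),
    Set.pair_comm s(x, y)]

lemma Switchable.reverse (h : Switchable G x y a b) : Switchable G y x b a :=
  ⟨h.adj_left.symm, h.adj_right.symm, h.ne_yb, h.ne_ya, h.ne_xb, h.ne_xa, h.not_adj_yb,
    h.not_adj_xa⟩

lemma Switchable.swap (h : Switchable G x y a b) : Switchable G a b x y :=
  ⟨h.adj_right, h.adj_left, h.ne_xa.symm, h.ne_ya.symm, h.ne_xb.symm, h.ne_yb.symm,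
    fun h' => h.not_adj_xa h'.symm, fun h' => h.not_adj_yb h'.symm⟩

lemma switchable_of_three_lt_edist (hxy : G.Adj x y) (hab : G.Adj a b) (h : 3 < G.edist x a) :
    Switchable G x y a b := by
  have hwalk (w : G.Walk x a) : 3 < w.length := by exact_mod_cast h.trans_le w.edist_le
  refine ⟨hxy, hab, ?_, ?_, ?_, ?_, ?_, ?_⟩
  · rintro rfl
    simpa using hwalk .nil
  · rintro rfl
    simpa using hwalk (.cons hab.symm .nil)
  · rintro rfl
    simpa using hwalk (.cons hxy .nil)
  · rintro rfl
    simpa using hwalk (.cons hxy (.cons hab.symm .nil))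
  · exact fun hxa => by simpa using hwalk (.cons hxa .nil)
  · exact fun hyb => by simpa using hwalk (.cons hxy (.cons hyb (.cons hab.symm .nil)))

lemma edgeSet_switch (hxa : x ≠ a) (hyb : y ≠ b) :
    (switch G x y a b).edgeSet = G.edgeSet \ {s(x, y), s(a, b)} ∪ {s(x, a), s(y, b)} := by
  have hdiag : Disjoint {s(x, a), s(y, b)} (Sym2.diagSet (α := V)) := by simp [hxa, hyb]
  rw [switch, SimpleGraph.edgeSet_sup, SimpleGraph.edgeSet_deleteEdges,
    SimpleGraph.edgeSet_fromEdgeSet, hdiag.sdiff_eq_left]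

lemma switch_adj (hxa : x ≠ a) (hyb : y ≠ b) {u v : V} :
    (switch G x y a b).Adj u v ↔
      (G.Adj u v ∧ ¬ (s(u, v) = s(x, y) ∨ s(u, v) = s(a, b))) ∨
        s(u, v) = s(x, a) ∨ s(u, v) = s(y, b) := by
  rw [← SimpleGraph.mem_edgeSet, edgeSet_switch hxa hyb]
  rfl

lemma switch_switch (h : Switchable G x y a b) : switch (switch G x y a b) x a y b = G := by
  refine SimpleGraph.edgeSet_injective ?_
  rw [edgeSet_switch h.adj_left.ne h.adj_right.ne, edgeSet_switch h.ne_xa h.ne_yb]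
  have hold : {s(x, y), s(a, b)} ⊆ G.edgeSet := Set.pair_subset h.adj_left h.adj_right
  have hnew : Disjoint G.edgeSet {s(x, a), s(y, b)} := by
    simpa [Set.disjoint_right] using ⟨h.not_adj_xa, h.not_adj_yb⟩
  rw [Set.union_sdiff_right, (hnew.mono_left Set.sdiff_subset).sdiff_eq_left,
    Set.sdiff_union_of_subset hold]

lemma switch_adj_left (h : Switchable G x y a b) {v : V} :
    (switch G x y a b).Adj x v ↔ v = a ∨ (v ≠ y ∧ G.Adj x v) := by
  rw [switch_adj h.ne_xa h.ne_yb]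
  have hxy := h.adj_left.ne
  have hxa := h.ne_xa
  have hxb := h.ne_xb
  simp only [Sym2.eq_iff]
  tauto

lemma switch_adj_of_notMem (hxa : x ≠ a) (hyb : y ≠ b) {u : V} (hu : u ∉ ({x, y, a, b} : Set V))
    {v : V} : (switch G x y a b).Adj u v ↔ G.Adj u v := by
  rw [switch_adj hxa hyb]
  simp only [Set.mem_insert_iff, Set.mem_singleton_iff] at hu
  simp only [Sym2.eq_iff]
  tauto

lemma switch_adj_xa (h : Switchable G x y a b) : (switch G x y a b).Adj x a :=
  (switch_adj_left h).2 (Or.inl rfl)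

lemma switch_adj_yb (h : Switchable G x y a b) : (switch G x y a b).Adj y b := by
  rw [switch_reverse]
  exact switch_adj_xa h.reverse

/-- If `a` is far from `x`, a short cycle through `xy` avoids `a`, so that switching breaks it only
at `xy`. -/
lemma edist_switch_le {L : ℕ} (hs : Switchable G x y a b) (h : IsShortCycleEdge G L x y)
    (ha : L < G.edist x a) : (switch G x y a b).edist x y ≤ L := by
  obtain ⟨w, hw⟩ := exists_walk_length_le_of_edist_le h.2
  have hsupp : a ∉ w.support := fun hmem => ha.not_ge <|
    (SimpleGraph.edist_anti (G.deleteEdges_le _)).trans <| (w.takeUntil a hmem).edist_le.trans <| by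
      exact_mod_cast (w.length_takeUntil_le_length hmem).trans hw
  have hedges : ∀ e ∈ w.edges, e ∈ (switch G x y a b).edgeSet := by
    intro e he
    have heG := w.edges_subset_edgeSet he
    rw [SimpleGraph.edgeSet_deleteEdges] at heG
    rw [edgeSet_switch hs.ne_xa hs.ne_yb]
    refine Or.inl ⟨heG.1, ?_⟩
    rintro (rfl | rfl)
    · exact heG.2 rfl
    · exact hsupp (w.fst_mem_support_of_mem_edges he)
  refine (w.transfer _ hedges).edist_le.trans ?_
  rw [SimpleGraph.Walk.length_transfer]
  exact_mod_cast hw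

variable [Fintype V]

lemma degree_switch_left (h : Switchable G x y a b) :
    (switch G x y a b).degree x = G.degree x := by
  have hnbr : (switch G x y a b).neighborFinset x = insert a ((G.neighborFinset x).erase y) := by
    ext v
    simp [switch_adj_left h]
  have hy : y ∈ G.neighborFinset x := by simpa using h.adj_left
  rw [← SimpleGraph.card_neighborFinset_eq_degree, hnbr, card_insert_of_notMem,
    card_erase_add_one hy, SimpleGraph.card_neighborFinset_eq_degree]
  simp [h.not_adj_xa]

lemma degree_switch (h : Switchable G x y a b) (v : V) :
    (switch G x y a b).degree v = G.degree v := by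
  by_cases hv : v ∈ ({x, y, a, b} : Set V)
  · obtain rfl | rfl | rfl | rfl := hv
    · exact degree_switch_left h
    · rw [switch_reverse]
      exact degree_switch_left h.reverse
    · rw [switch_swap]
      exact degree_switch_left h.swap
    · rw [switch_swap, switch_reverse]
      exact degree_switch_left h.swap.reverse
  · rw [← SimpleGraph.card_neighborFinset_eq_degree, ← SimpleGraph.card_neighborFinset_eq_degree]
    congr 1
    ext w
    simp only [SimpleGraph.mem_neighborFinset, switch_adj_of_notMem h.ne_xa h.ne_yb hv]

end Switch

section Counting

variable {V : Type*} [Fintype V] {G : SimpleGraph V} {d L : ℕ}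

/-- The `d`-regular graphs on the vertex set `V`. -/
def regularGraphs (V : Type*) [Fintype V] (d : ℕ) : Finset (SimpleGraph V) :=
  {G | G.IsRegularOfDegree d}

lemma mem_regularGraphs : G ∈ regularGraphs V d ↔ G.IsRegularOfDegree d := by
  simp [regularGraphs]

/-- The oriented edges of `G` that start at distance more than `r` from `x`. -/
def farDarts (G : SimpleGraph V) (x : V) (r : ℕ) : Finset (Σ _ : V, V) :=
  (closedBall G x r)ᶜ.sigma fun a => G.neighborFinset a

/-- The possible switchings of short cycles in `d`-regular graphs: a graph, a dart `xy` on a short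
cycle, and a dart `ab` so far from `x` that switching at `xy` and `ab` creates no multiple edge and
keeps the rest of the cycle. -/
def cycleSwitchings (V : Type*) [Fintype V] (d L : ℕ) :
    Finset (Σ _ : SimpleGraph V, Σ _ : V × V, Σ _ : V, V) :=
  (regularGraphs V d).sigma fun G => (shortCycleDarts G L).sigma fun q => farDarts G q.1 (L + 3)

/-- The possible outcomes of the switchings in `cycleSwitchings V d L`: a graph, two vertices `x`
and `y` at distance at most `L`, and neighbors `a` of `x` and `b` of `y`. -/
def closePairsWithNeighbors (V : Type*) [Fintype V] (d L : ℕ) :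
    Finset (Σ _ : SimpleGraph V, Σ _ : V × V, Σ _ : V, V) :=
  (regularGraphs V d).sigma fun G => ({q : V × V | G.edist q.1 q.2 ≤ L} : Finset _).sigma fun q =>
    (G.neighborFinset q.1).sigma fun _ => G.neighborFinset q.2

lemma le_card_farDarts (hG : G.IsRegularOfDegree d) (x : V) (r : ℕ) :
    (Fintype.card V - (d + 1) ^ r) * d ≤ #(farDarts G x r) := by
  have hball := card_closedBall_le (fun v => (hG v).le) x r
  rw [farDarts, card_sigma, sum_congr rfl fun a _ =>
    (G.card_neighborFinset_eq_degree a).trans (hG a), sum_const, smul_eq_mul, card_compl]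
  gcongr

lemma le_card_cycleSwitchings (V : Type*) [Fintype V] (d L : ℕ) :
    (∑ G ∈ regularGraphs V d, #(shortCycleDarts G L)) *
      ((Fintype.card V - (d + 1) ^ (L + 3)) * d) ≤ #(cycleSwitchings V d L) := by
  rw [cycleSwitchings, card_sigma, sum_mul]
  refine sum_le_sum fun G hG => ?_
  rw [card_sigma, ← smul_eq_mul]
  exact card_nsmul_le_sum _ _ _ fun q _ => le_card_farDarts (mem_regularGraphs.1 hG) q.1 _

lemma card_edist_le_le (hG : G.IsRegularOfDegree d) (L : ℕ) :
    #{q : V × V | G.edist q.1 q.2 ≤ L} ≤ Fintype.card V * (d + 1) ^ L := by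
  calc #{q : V × V | G.edist q.1 q.2 ≤ L} = ∑ x, #(closedBall G x L) := by
        simp only [closedBall, card_filter, Fintype.sum_prod_type]
    _ ≤ ∑ _x : V, (d + 1) ^ L :=
        sum_le_sum fun x _ => card_closedBall_le (fun v => (hG v).le) x L
    _ = Fintype.card V * (d + 1) ^ L := by simp

lemma card_closePairsWithNeighbors_le (V : Type*) [Fintype V] (d L : ℕ) :
    #(closePairsWithNeighbors V d L) ≤
      #(regularGraphs V d) * (Fintype.card V * (d + 1) ^ L * (d * d)) := by
  rw [closePairsWithNeighbors, card_sigma, ← smul_eq_mul]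
  refine sum_le_card_nsmul _ _ _ fun G hG => ?_
  have hreg := mem_regularGraphs.1 hG
  have hnbr (q : V × V) :
      #((G.neighborFinset q.1).sigma fun _ => G.neighborFinset q.2) = d * d := by
    simp only [card_sigma, sum_const, smul_eq_mul, SimpleGraph.card_neighborFinset_eq_degree,
      hreg q.1, hreg q.2]
  rw [card_sigma, sum_congr rfl fun q _ => hnbr q, sum_const, smul_eq_mul]
  exact Nat.mul_le_mul_right _ (card_edist_le_le hreg L)

lemma lt_edist_of_mem_farDarts {x : V} {r : ℕ} {q : Σ _ : V, V} (h : q ∈ farDarts G x r) :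
    r < G.edist x q.1 := by
  simpa [farDarts, mem_closedBall] using (mem_sigma.1 h).1

lemma switchable_of_mem_farDarts {q : V × V} (hq : q ∈ shortCycleDarts G L) {q' : Σ _ : V, V}
    (hq' : q' ∈ farDarts G q.1 (L + 3)) : Switchable G q.1 q.2 q'.1 q'.2 :=
  switchable_of_three_lt_edist (mem_filter.1 hq).2.1
    ((G.mem_neighborFinset _ _).1 (mem_sigma.1 hq').2)
    (lt_of_le_of_lt (by exact_mod_cast Nat.le_add_left 3 L) (lt_edist_of_mem_farDarts hq'))

lemma card_cycleSwitchings_le (V : Type*) [Fintype V] (d L : ℕ) :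
    #(cycleSwitchings V d L) ≤ #(closePairsWithNeighbors V d L) := by
  refine card_le_card_of_injOn
    (fun t => ⟨switch t.1 t.2.1.1 t.2.1.2 t.2.2.1 t.2.2.2, t.2⟩) ?_ ?_
  · rintro ⟨G, q, q'⟩ ht
    obtain ⟨hG, hq, hq'⟩ : G ∈ regularGraphs V d ∧ q ∈ shortCycleDarts G L ∧
      q' ∈ farDarts G q.1 (L + 3) := by simpa [cycleSwitchings] using ht
    have hs := switchable_of_mem_farDarts hq hq'
    have hfar : L < G.edist q.1 q'.1 :=
      lt_of_le_of_lt (by exact_mod_cast Nat.le_add_right L 3) (lt_edist_of_mem_farDarts hq')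
    have hreg : (switch G q.1 q.2 q'.1 q'.2).IsRegularOfDegree d :=
      fun v => (degree_switch hs v).trans (mem_regularGraphs.1 hG v)
    have hclose := edist_switch_le hs (mem_filter.1 hq).2 hfar
    simpa [closePairsWithNeighbors, mem_regularGraphs] using
      ⟨hreg, hclose, switch_adj_xa hs, switch_adj_yb hs⟩
  · rintro ⟨G, q, q'⟩ ht ⟨H, r, r'⟩ ht' h
    obtain ⟨-, hq, hq'⟩ : G ∈ regularGraphs V d ∧ q ∈ shortCycleDarts G L ∧
      q' ∈ farDarts G q.1 (L + 3) := by simpa [cycleSwitchings] using ht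
    obtain ⟨-, hr, hr'⟩ : H ∈ regularGraphs V d ∧ r ∈ shortCycleDarts H L ∧
      r' ∈ farDarts H r.1 (L + 3) := by simpa [cycleSwitchings] using ht'
    obtain ⟨hswitch, ⟨⟩⟩ : switch G q.1 q.2 q'.1 q'.2 = switch H r.1 r.2 r'.1 r'.2 ∧
      (⟨q, q'⟩ : Σ _ : V × V, Σ _ : V, V) = ⟨r, r'⟩ := by simpa using h
    rw [← switch_switch (switchable_of_mem_farDarts hq hq'), hswitch,
      switch_switch (switchable_of_mem_farDarts hr hr')]

theorem sum_card_shortCycleDarts_mul_le (V : Type*) [Fintype V] (hd : 0 < d) (L : ℕ) :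
    (∑ G ∈ regularGraphs V d, #(shortCycleDarts G L)) *
      (Fintype.card V - (d + 1) ^ (L + 3)) ≤
        #(regularGraphs V d) * (Fintype.card V * (d + 1) ^ L * d) := by
  refine Nat.le_of_mul_le_mul_right ?_ hd
  linarith [(le_card_cycleSwitchings V d L).trans
    ((card_cycleSwitchings_le V d L).trans (card_closePairsWithNeighbors_le V d L))]

end Counting

/-! ### Random cubic graphs -/

lemma cubicGraphs_eq_regularGraphs (n : ℕ) : cubicGraphs n = regularGraphs (Fin n) 3 := by
  ext G
  rw [mem_regularGraphs, cubicGraphs, mem_filter_univ]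

section Existence

lemma isRegularOfDegree_circulantGraph {Γ : Type*} [AddGroup Γ] {s : Finset Γ}
    [(SimpleGraph.circulantGraph (s : Set Γ)).LocallyFinite] (hneg : ∀ x ∈ s, -x ∈ s) (h0 : 0 ∉ s) :
    (SimpleGraph.circulantGraph (s : Set Γ)).IsRegularOfDegree #s := by
  intro u
  rw [← SimpleGraph.card_neighborFinset_eq_degree, ← card_map (s := s) (addRightEmbedding u)]
  congr 1
  ext v
  have hsymm : u - v ∈ s ↔ v - u ∈ s :=
    ⟨fun h => neg_sub u v ▸ hneg _ h, fun h => neg_sub v u ▸ hneg _ h⟩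
  have hne (h : v - u ∈ s) : u ≠ v := fun huv => h0 (by simpa [huv] using h)
  simpa [hsymm, ← eq_sub_iff_add_eq] using hne

/-- The witness is the Möbius ladder: an even cycle with its opposite vertices joined. -/
lemma cubicGraphs_nonempty {n : ℕ} (hn : 4 ≤ n) (he : Even n) : (cubicGraphs n).Nonempty := by
  obtain ⟨k, rfl⟩ := he
  have : NeZero (k + k) := ⟨by omega⟩
  let s : Finset (Fin (k + k)) := {⟨1, by omega⟩, ⟨k + k - 1, by omega⟩, ⟨k, by omega⟩}
  have hneg : ∀ x ∈ s, -x ∈ s := by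
    simp only [s, mem_insert, mem_singleton, forall_eq_or_imp, forall_eq]
    simp only [Fin.ext_iff, Fin.val_neg']
    refine ⟨Or.inr (Or.inl ?_), Or.inl ?_, Or.inr (Or.inr ?_)⟩ <;> rw [Nat.mod_eq_of_lt] <;> omega
  have h0 : 0 ∉ s := by
    simp only [s, mem_insert, mem_singleton, Fin.ext_iff, Fin.val_zero]
    omega
  have hs : #s = 3 := card_eq_three.2 ⟨_, _, _, by grind, by grind, by grind, rfl⟩
  refine ⟨SimpleGraph.circulantGraph (s : Set (Fin (k + k))), ?_⟩
  rw [cubicGraphs_eq_regularGraphs, mem_regularGraphs, ← hs]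
  convert isRegularOfDegree_circulantGraph hneg h0

end Existence

section NonTreeFraction

variable {V : Type*} [Fintype V] {G : SimpleGraph V} {d : ℕ}

lemma nonTreeFraction_nonneg (G : SimpleGraph V) (p : ℕ) : 0 ≤ nonTreeFraction G p :=
  div_nonneg (Nat.cast_nonneg _) (Nat.cast_nonneg _)

lemma nonTreeFraction_le_one (G : SimpleGraph V) (p : ℕ) : nonTreeFraction G p ≤ 1 :=
  div_le_one_of_le₀ (by exact_mod_cast card_filter_le _ _) (Nat.cast_nonneg _)

lemma card_mul_nonTreeFraction_le (hG : G.IsRegularOfDegree d) (p : ℕ) :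
    Fintype.card V * nonTreeFraction G p ≤
      2 * (d + 1) ^ p * #(shortCycleDarts G (nbhdBound d p)) := by
  have hedges : (2 : ℝ) * #G.edgeFinset = d * Fintype.card V := by
    exact_mod_cast two_mul_card_edgeFinset hG
  have hbad : (#{e ∈ G.edgeFinset | ¬ IsTreeLike G e p} : ℝ) ≤
      #(shortCycleDarts G (nbhdBound d p)) * ((d + 1) ^ p * d) := by
    exact_mod_cast card_not_isTreeLike_le (fun v => (hG v).le) p
  rw [nonTreeFraction, mul_div_assoc']
  refine div_le_of_le_mul₀ (Nat.cast_nonneg _) (by positivity) ?_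
  calc Fintype.card V * (#{e ∈ G.edgeFinset | ¬ IsTreeLike G e p} : ℝ)
      ≤ Fintype.card V * (#(shortCycleDarts G (nbhdBound d p)) * ((d + 1) ^ p * d)) := by gcongr
    _ = (d + 1) ^ p * #(shortCycleDarts G (nbhdBound d p)) * (d * Fintype.card V) := by ring
    _ = _ := by rw [← hedges]; ring

lemma mul_sum_nonTreeFraction_le (V : Type*) [Fintype V] (hd : 0 < d) (p : ℕ) :
    (Fintype.card V - (d + 1) ^ (nbhdBound d p + 3) : ℕ) *
        ∑ G ∈ regularGraphs V d, nonTreeFraction G p ≤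
      2 * (d + 1) ^ p * (d + 1) ^ nbhdBound d p * d * #(regularGraphs V d) := by
  obtain hV | hV := (Fintype.card V).eq_zero_or_pos
  · rw [hV, Nat.zero_sub, Nat.cast_zero, zero_mul]
    positivity
  have hcycles : (∑ G ∈ regularGraphs V d, (#(shortCycleDarts G (nbhdBound d p)) : ℝ)) *
      (Fintype.card V - (d + 1) ^ (nbhdBound d p + 3) : ℕ) ≤
        #(regularGraphs V d) * (Fintype.card V * (d + 1) ^ nbhdBound d p * d) := by
    exact_mod_cast sum_card_shortCycleDarts_mul_le V hd (nbhdBound d p)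
  have hsum : Fintype.card V * ∑ G ∈ regularGraphs V d, nonTreeFraction G p ≤
      2 * (d + 1) ^ p * ∑ G ∈ regularGraphs V d, (#(shortCycleDarts G (nbhdBound d p)) : ℝ) := by
    rw [mul_sum, mul_sum]
    exact sum_le_sum fun G hG => card_mul_nonTreeFraction_le (mem_regularGraphs.1 hG) p
  generalize Fintype.card V - (d + 1) ^ (nbhdBound d p + 3) = k at hcycles ⊢
  refine le_of_mul_le_mul_left ?_ (Nat.cast_pos.2 hV : (0 : ℝ) < Fintype.card V)
  calc Fintype.card V * (k * ∑ G ∈ regularGraphs V d, nonTreeFraction G p)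
      = k * (Fintype.card V * ∑ G ∈ regularGraphs V d, nonTreeFraction G p) := by ring
    _ ≤ k * (2 * (d + 1) ^ p *
          ∑ G ∈ regularGraphs V d, (#(shortCycleDarts G (nbhdBound d p)) : ℝ)) := by gcongr
    _ = 2 * (d + 1) ^ p *
          ((∑ G ∈ regularGraphs V d, (#(shortCycleDarts G (nbhdBound d p)) : ℝ)) * k) := by ring
    _ ≤ 2 * (d + 1) ^ p *
          (#(regularGraphs V d) * (Fintype.card V * (d + 1) ^ nbhdBound d p * d)) := by gcongr
    _ = _ := by ring

/-- The constant in the `O(1/n)` bound for the mean non-tree fraction of `d`-regular graphs. The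
first term pays for the vertices too close to a short cycle to take part in a switching, the second
one for the switchings. -/
def meanConst (d p : ℕ) : ℝ :=
  (d + 1) ^ (nbhdBound d p + 3) + 2 * (d + 1) ^ p * (d + 1) ^ nbhdBound d p * d

lemma meanConst_pos (d p : ℕ) : 0 < meanConst d p := by
  unfold meanConst
  positivity

theorem card_mul_sum_nonTreeFraction_le (V : Type*) [Fintype V] (hd : 0 < d) (p : ℕ) :
    Fintype.card V * ∑ G ∈ regularGraphs V d, nonTreeFraction G p ≤
      meanConst d p * #(regularGraphs V d) := by
  have hcard : (Fintype.card V : ℝ) ≤ (d + 1) ^ (nbhdBound d p + 3) +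
      (Fintype.card V - (d + 1) ^ (nbhdBound d p + 3) : ℕ) := by
    exact_mod_cast le_add_tsub
  have hone : ∑ G ∈ regularGraphs V d, nonTreeFraction G p ≤ #(regularGraphs V d) := by
    simpa using sum_le_card_nsmul _ _ 1 fun G (_ : G ∈ regularGraphs V d) =>
      nonTreeFraction_le_one G p
  have hnonneg : 0 ≤ ∑ G ∈ regularGraphs V d, nonTreeFraction G p :=
    sum_nonneg fun G _ => nonTreeFraction_nonneg G p
  refine (mul_le_mul_of_nonneg_right hcard hnonneg).trans ?_
  rw [meanConst, add_mul, add_mul]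
  exact add_le_add (by gcongr) (mul_sum_nonTreeFraction_le V hd p)

end NonTreeFraction

section CubicProb

variable {n : ℕ} {P Q : SimpleGraph (Fin n) → Prop}

lemma cubicProb_mono (h : ∀ G ∈ cubicGraphs n, P G → Q G) : cubicProb n P ≤ cubicProb n Q := by
  unfold cubicProb
  gcongr ((?_ : ℕ) : ℝ) / _
  exact card_le_card fun G hG =>
    mem_filter.2 ⟨(mem_filter.1 hG).1, h G (mem_filter.1 hG).1 (mem_filter.1 hG).2⟩

lemma cubicProb_le_one (P : SimpleGraph (Fin n) → Prop) : cubicProb n P ≤ 1 :=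
  div_le_one_of_le₀ (by exact_mod_cast card_filter_le _ _) (Nat.cast_nonneg _)

lemma cubicPairProb_mono {P Q : SimpleGraph (Fin n) → SimpleGraph (Fin n) → Prop}
    (h : ∀ G ∈ cubicGraphs n, ∀ H ∈ cubicGraphs n, P G H → Q G H) :
    cubicPairProb n P ≤ cubicPairProb n Q := by
  unfold cubicPairProb
  gcongr ((?_ : ℕ) : ℝ) / _
  refine card_le_card fun q hq => ?_
  obtain ⟨hmem, hP⟩ := mem_filter.1 hq
  exact mem_filter.2 ⟨hmem, h _ (mem_product.1 hmem).1 _ (mem_product.1 hmem).2 hP⟩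

lemma cubicPairProb_and (P Q : SimpleGraph (Fin n) → Prop) :
    cubicPairProb n (fun G H => P G ∧ Q H) = cubicProb n P * cubicProb n Q := by
  rw [cubicPairProb, cubicProb, cubicProb, div_mul_div_comm, ← Nat.cast_mul, ← Nat.cast_mul,
    ← card_product, ← card_product]
  congr 3
  ext q
  simp only [mem_filter, mem_product, and_and_and_comm]

lemma one_sub_le_cubicPairProb_and {ε : ℝ} (h : 1 - ε / 2 ≤ cubicProb n P) :
    1 - ε ≤ cubicPairProb n fun G H => P G ∧ P H := by
  rw [cubicPairProb_and]
  nlinarith [sq_nonneg (cubicProb n P - 1)]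

lemma one_sub_cubicMean_div_le_cubicProb (hne : (cubicGraphs n).Nonempty)
    {X : SimpleGraph (Fin n) → ℝ} (hX : ∀ G, 0 ≤ X G) {t : ℝ} (ht : 0 < t) :
    1 - cubicMean n X / t ≤ cubicProb n fun G => X G ≤ t := by
  have hcard : (0 : ℝ) < #(cubicGraphs n) := by exact_mod_cast card_pos.2 hne
  have hlarge : #{G ∈ cubicGraphs n | ¬ X G ≤ t} * t ≤ ∑ G ∈ cubicGraphs n, X G := by
    rw [← nsmul_eq_mul]
    exact (card_nsmul_le_sum _ X _ fun G hG => (not_le.1 (mem_filter.1 hG).2).le).trans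
      (sum_le_sum_of_subset_of_nonneg (filter_subset _ _) fun G _ _ => hX G)
  have hsplit : (#{G ∈ cubicGraphs n | X G ≤ t} : ℝ) + #{G ∈ cubicGraphs n | ¬ X G ≤ t} =
      #(cubicGraphs n) := by
    exact_mod_cast card_filter_add_card_filter_not _
  rw [cubicProb, cubicMean, div_right_comm, one_sub_div hcard.ne']
  gcongr
  linarith [(le_div_iff₀ ht).2 hlarge]

end CubicProb

section Concentration

variable {n : ℕ}

theorem cubicMean_nonTreeFraction_le (hn : 0 < n) (p : ℕ) :
    cubicMean n (fun G => nonTreeFraction G p) ≤ meanConst 3 p / n := by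
  have hn' : (0 : ℝ) < n := Nat.cast_pos.2 hn
  rw [cubicMean, cubicGraphs_eq_regularGraphs]
  refine div_le_of_le_mul₀ (Nat.cast_nonneg _) (div_nonneg (meanConst_pos 3 p).le hn'.le) ?_
  rw [div_mul_eq_mul_div, le_div_iff₀' hn']
  simpa using card_mul_sum_nonTreeFraction_le (Fin n) three_pos p

theorem one_sub_le_cubicProb_nonTreeFraction_le (hn : 4 ≤ n) (he : Even n) (p : ℕ) {ε : ℝ}
    (hε : 0 < ε) : 1 - ε ≤ cubicProb n fun G => nonTreeFraction G p ≤ meanConst 3 p / ε / n := by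
  have hpos : 0 < n := by omega
  have ht : 0 < meanConst 3 p / ε / n :=
    div_pos (div_pos (meanConst_pos 3 p) hε) (Nat.cast_pos.2 hpos)
  refine le_trans ?_ (one_sub_cubicMean_div_le_cubicProb (cubicGraphs_nonempty hn he)
    (fun G => nonTreeFraction_nonneg G p) ht)
  gcongr
  rw [div_le_iff₀ ht]
  refine (cubicMean_nonTreeFraction_le hpos p).trans_eq ?_
  field_simp

theorem one_sub_le_cubicProb_concentrated (hn : 4 ≤ n) (he : Even n) (p : ℕ) {ε : ℝ} (hε : 0 < ε) :
    1 - ε ≤ cubicProb n fun G => nonTreeFraction G p ≤ meanConst 3 p / ε / n ∧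
      ∀ γ β : Fin p → ℝ, |objectivePerEdge G γ β - treeTerm γ β| ≤ meanConst 3 p / ε / n := by
  have : Nonempty (Fin n) := ⟨⟨0, by omega⟩⟩
  exact (one_sub_le_cubicProb_nonTreeFraction_le hn he p hε).trans <| cubicProb_mono
    fun G hG hle => ⟨hle, fun γ β => (abs_objectivePerEdge_sub_treeTerm_le
      (mem_regularGraphs.1 (cubicGraphs_eq_regularGraphs n ▸ hG)) γ β).trans hle⟩

theorem tendsto_cubicProb_abs_sub_treeTerm_le (p : ℕ) {δ : ℝ} (hδ : 0 < δ) :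
    Tendsto (fun n => cubicProb n fun G => ∀ γ β : Fin p → ℝ,
      |objectivePerEdge G γ β - treeTerm γ β| ≤ δ) (atTop ⊓ 𝓟 {n : ℕ | Even n}) (𝓝 1) := by
  refine tendsto_order.2 ⟨fun a ha => ?_, fun a ha => Eventually.of_forall fun n =>
    (cubicProb_le_one _).trans_lt ha⟩
  obtain ⟨b, hab, hb⟩ := exists_between ha
  have hlim : Tendsto (fun n : ℕ => meanConst 3 p / (1 - b) / n) atTop (𝓝 0) :=
    tendsto_const_div_atTop_nhds_zero_nat _
  rw [eventually_inf_principal]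
  filter_upwards [eventually_ge_atTop 4, hlim.eventually_le_const hδ] with n hn hle he
  calc a < 1 - (1 - b) := by rwa [sub_sub_cancel]
    _ ≤ _ := one_sub_le_cubicProb_concentrated hn he p (sub_pos.2 hb)
    _ ≤ _ := cubicProb_mono fun G _ h γ β => (h.2 γ β).trans hle

theorem one_sub_le_cubicPairProb_abs_sub_le (hn : 4 ≤ n) (he : Even n) (p : ℕ) {ε : ℝ}
    (hε : 0 < ε) :
    1 - ε ≤ cubicPairProb n fun G H => ∀ γ β : Fin p → ℝ,
      |objectivePerEdge G γ β - objectivePerEdge H γ β| ≤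
        2 * (meanConst 3 p / (ε / 2)) / n := by
  refine (one_sub_le_cubicPairProb_and
    (one_sub_le_cubicProb_concentrated hn he p (half_pos hε))).trans ?_
  refine cubicPairProb_mono fun G _ H _ h γ β => ?_
  calc |objectivePerEdge G γ β - objectivePerEdge H γ β|
      ≤ |objectivePerEdge G γ β - treeTerm γ β| + |objectivePerEdge H γ β - treeTerm γ β| := by
        rw [abs_sub_comm (objectivePerEdge H γ β)]
        exact abs_sub_le _ _ _
    _ ≤ meanConst 3 p / (ε / 2) / n + meanConst 3 p / (ε / 2) / n :=
        add_le_add (h.1.2 γ β) (h.2.2 γ β)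
    _ = _ := by ring

end Concentration

end QAOA

end

theorem mainTheorem1 (p : ℕ) :
    -- the objective function is the sum of the edge terms
    (∀ (V : Type) [Fintype V] (G : SimpleGraph V) (γ β : Fin p → ℝ),
      QAOA.objective G γ β = ∑ e ∈ G.edgeFinset, QAOA.edgeTerm G e γ β) ∧
    -- each edge term is determined by the radius `p` neighborhood of the edge
    (∀ (V W : Type) [Fintype V] [Fintype W] (G : SimpleGraph V) (H : SimpleGraph W),
      ∀ e ∈ G.edgeSet, ∀ f ∈ H.edgeSet, QAOA.SameNbhd G e H f p →
        ∀ γ β : Fin p → ℝ, QAOA.edgeTerm G e γ β = QAOA.edgeTerm H f γ β) ∧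
    -- in a 3-regular graph, an edge with a tree neighborhood contributes the tree term
    (∀ (V : Type) [Fintype V] (G : SimpleGraph V), G.IsRegularOfDegree 3 →
      ∀ e ∈ G.edgeSet, QAOA.IsTreeLike G e p →
        ∀ γ β : Fin p → ℝ, QAOA.edgeTerm G e γ β = QAOA.treeTerm γ β) ∧
    -- hence the objective per edge is close to the tree term if most neighborhoods are trees
    (∀ (V : Type) [Fintype V] [Nonempty V] (G : SimpleGraph V), G.IsRegularOfDegree 3 →
      ∀ γ β : Fin p → ℝ,
        |QAOA.objectivePerEdge G γ β - QAOA.treeTerm γ β| ≤ QAOA.nonTreeFraction G p) ∧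
    -- the mean fraction of edges whose neighborhood is not a tree is `O(1/n)`
    (∃ K : ℝ, ∀ n : ℕ, 4 ≤ n → Even n →
      QAOA.cubicMean n (fun G => QAOA.nonTreeFraction G p) ≤ K / n) ∧
    -- for typical graphs, the non-tree fraction and the deviation of the whole landscape from
    -- the tree term are of order `1/n`
    (∀ ε : ℝ, 0 < ε → ∃ K : ℝ, ∀ n : ℕ, 4 ≤ n → Even n →
      1 - ε ≤ QAOA.cubicProb n (fun G => QAOA.nonTreeFraction G p ≤ K / n ∧
        ∀ γ β : Fin p → ℝ,
          |QAOA.objectivePerEdge G γ β - QAOA.treeTerm γ β| ≤ K / n)) ∧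
    -- for almost all graphs the whole landscape agrees with the tree term up to `o(1)`
    (∀ δ : ℝ, 0 < δ →
      Tendsto (fun n => QAOA.cubicProb n (fun G => ∀ γ β : Fin p → ℝ,
          |QAOA.objectivePerEdge G γ β - QAOA.treeTerm γ β| ≤ δ))
        (atTop ⊓ 𝓟 {n : ℕ | Even n}) (𝓝 1)) ∧
    -- two independent typical instances have the same landscape up to order `1/n`
    (∀ ε : ℝ, 0 < ε → ∃ K : ℝ, ∀ n : ℕ, 4 ≤ n → Even n →
      1 - ε ≤ QAOA.cubicPairProb n (fun G H => ∀ γ β : Fin p → ℝ,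
        |QAOA.objectivePerEdge G γ β - QAOA.objectivePerEdge H γ β| ≤ K / n)) :=
  ⟨fun _ _ G γ β => QAOA.objective_eq_sum_edgeTerm G γ β,
    fun _ _ _ _ _ _ _ _ _ _ h γ β => QAOA.edgeTerm_eq_of_sameNbhd h γ β,
    fun _ _ _ hG _ he ht γ β => QAOA.edgeTerm_eq_treeTerm hG he ht γ β,
    fun _ _ _ _ hG γ β => QAOA.abs_objectivePerEdge_sub_treeTerm_le hG γ β,
    ⟨QAOA.meanConst 3 p, fun _ hn _ => QAOA.cubicMean_nonTreeFraction_le (by omega) p⟩,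
    fun ε hε => ⟨QAOA.meanConst 3 p / ε, fun _ hn he =>
      QAOA.one_sub_le_cubicProb_concentrated hn he p hε⟩,
    fun _ hδ => QAOA.tendsto_cubicProb_abs_sub_treeTerm_le p hδ,
    fun ε hε => ⟨2 * (QAOA.meanConst 3 p / (ε / 2)), fun _ hn he =>
      QAOA.one_sub_le_cubicPairProb_abs_sub_le hn he p hε⟩⟩
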